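/- **Progress for LinksT.** Let $M$ be a LinksT term, $\Gamma$ a context and $A$ a type with $\Gamma\vdash M:A$. Then $M$ is in LinksT normal form, or there is a LinksT term $M'$ with $M\leadsto M'$. The calculus LinksT is as follows; expressions are taken up to renaming of bound variables, and bound variables are chosen fresh. **Syntax.** Here $c$ ranges over Boolean, integer and string literals, and rows are lists of labelled components (there is no rule for reordering them). - Kinds $K ::= \mathit{Type}\mid\mathit{BaseType}\mid\mathit{Row}\mid\mathit{BaseRow}\mid K_1\to K_2$. - Constructors $C,D ::= \mathtt{Bool}^*\mid\mathtt{Int}^*\mid\mathtt{String}^*\mid\alpha\mid\lambda\alpha{:}K.C\mid C\,D\mid C\,S\mid\mathtt{List}^*\,C\mid\mathtt{Record}^*\,S\mid\mathtt{Trace}^*\,C\mid\mathsf{Typerec}\,C\,(C_B,C_I,C_S,C_L,C_R,C_T)$. - Row constructors $S ::= \cdot\mid l:C;S\mid\rho\mid\mathsf{Rmap}\,C\,S$. Row variables $\rho$ are exactly the type-level variables of kind $\mathit{Row}$ or $\mathit{BaseRow}$; all others are type variables $\alpha$. - Types $A,B ::= \mathtt T(C)\mid\mathtt{Bool}\mid\mathtt{Int}\mid\mathtt{String}\mid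 A\to B\mid\mathtt{List}\,A\mid\mathtt{Record}\,R\mid\mathtt{Trace}\,A\mid\forall\alpha{:}K.A$; row types $R ::= \cdot\mid l:A;R\mid\mathtt T(S)$. We write $\langle R\rangle$ for $\mathtt{Record}\,R$, also in $\mathsf{table}\,n\,\langle R\rangle$. - Terms $L,M,N ::= c\mid x\mid\lambda x{:}A.M\mid M\,N\mid\Lambda\alpha{:}K.M\mid M\,C\mid M\,S\mid\mathsf{fix}\,f{:}A.M\mid\mathsf{if}\,L\,\mathsf{then}\,M\,\mathsf{else}\,N\mid M+N\mid M==N\mid\langle\rangle\mid\langle l=M;N\rangle\mid M.l\mid\mathsf{rmap}^S\,M\,N\mid\mathsf{rfold}^S\,L\,M\,N\mid[]\mid[M]\mid M\mathbin{+\!\!+}N\mid\mathsf{for}\,(x\leftarrow M)\,N\mid\mathsf{table}\,n\,\langle R\rangle\mid\mathtt{Lit}\,M\mid\mathtt{If}\,M\mid\mathtt{For}\,C\,M\mid\mathtt{Cell}\,M\mid\mathtt{OpEq}\,C\,M\mid\mathtt{OpPlus}\,M\mid\mathsf{tracecase}\,M\,\mathsf{of}\,(x.M_L,x.M_I,\alpha.x.M_F,x.M_C,\alpha.x.M_E,x.M_P)\mid\mathsf{typecase}\,C\,\mathsf{of}\,(M_B,M_I,M_S,\beta.M_L,\rho.M_R,\gamma.M_T)$.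 Here $\Lambda\alpha{:}K$, $\lambda\alpha{:}K$ and $\forall\alpha{:}K$ bind a row variable if $K\in\{\mathit{Row},\mathit{BaseRow}\}$. A context $\Gamma$ assigns kinds to type and row variables and types to term variables; it is well formed if every type in it has kind $\mathit{Type}$. **Kinding.** Subkinding is the structural (contravariant/covariant on arrows) relation generated by $\mathit{BaseType}\le\mathit{Type}$ and $\mathit{BaseRow}\le\mathit{Row}$; all kinding and equivalence judgements of constructors and types are closed under it. Constructors: $\mathtt{Bool}^*,\mathtt{Int}^*,\mathtt{String}^*:\mathit{BaseType}$; variables have their kind in $\Gamma$; $\lambda\alpha{:}K_1.C:K_1\to K_2$ if $\Gamma,\alpha{:}K_1\vdash C:K_2$; an application of $C:K_1\to K_2$ to an argument of kind $K_1$ has kind $K_2$, the argument being a row constructor if $K_1\in\{\mathit{Row},\mathit{BaseRow}\}$ and a constructor otherwise; $\mathtt{List}^*C:\mathit{Type}$ if $C:\mathit{Type}$; $\mathtt{Record}^*S:\mathit{Type}$ if $S:\mathit{Row}$; $\mathtt{Trace}^*C:\mathit{Type}$ if $C:\mathit{BaseType}$; $\mathsf{Typerec}\,C\,(C_B,\dots,C_T):K$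 if $C:\mathit{Type}$, $C_B,C_I,C_S:K$, $C_L:\mathit{Type}\to K\to K$, $C_R:\mathit{Row}\to\mathit{Row}\to K$, $C_T:\mathit{BaseType}\to K\to K$; $\cdot:\mathit{Row}$ and $\cdot:\mathit{BaseRow}$; $l{:}C;S$ has kind $\mathit{Row}$ if $C:\mathit{Type}$, $S:\mathit{Row}$, and kind $\mathit{BaseRow}$ if $C:\mathit{BaseType}$, $S:\mathit{BaseRow}$; $\mathsf{Rmap}\,C\,S:\mathit{Row}$ if $C:\mathit{Type}\to\mathit{Type}$, $S:\mathit{Row}$. Types: $\mathtt T(C)$ has kind $\mathit{Type}$ (resp. $\mathit{BaseType}$) if $C$ has, $\mathtt T(S)$ has kind $\mathit{Row}$ (resp. $\mathit{BaseRow}$) if $S$ has; $\mathtt{Bool},\mathtt{Int},\mathtt{String}:\mathit{BaseType}$; $A\to B$, $\mathtt{List}\,A$, $\forall\alpha{:}K.A$ have kind $\mathit{Type}$ if $A,B$ do (in $\Gamma,\alpha{:}K$ for $\forall$); $\mathtt{Record}\,R:\mathit{Type}$ if $R:\mathit{Row}$; $\mathtt{Trace}\,A:\mathit{Type}$ if $A:\mathit{BaseType}$;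 $\cdot$ and $l{:}A;R$ as for row constructors. **Constructor reduction** $\leadsto$ is the closure under all constructor and row constructor contexts of: $(\lambda\alpha{:}K.C)\,D\leadsto C[\alpha:=D]$ (likewise for a row argument, when $K$ is $\mathit{Row}$ or $\mathit{BaseRow}$); $\mathsf{Rmap}\,C\,\cdot\leadsto\cdot$; $\mathsf{Rmap}\,C\,(l{:}D;S)\leadsto(l{:}C\,D;\mathsf{Rmap}\,C\,S)$; and, writing $\vec C=(C_B,C_I,C_S,C_L,C_R,C_T)$, $\mathsf{Typerec}\,\mathtt{Bool}^*\,\vec C\leadsto C_B$, $\mathsf{Typerec}\,\mathtt{Int}^*\,\vec C\leadsto C_I$, $\mathsf{Typerec}\,\mathtt{String}^*\,\vec C\leadsto C_S$, $\mathsf{Typerec}\,(\mathtt{List}^*D)\,\vec C\leadsto C_L\,D\,(\mathsf{Typerec}\,D\,\vec C)$, $\mathsf{Typerec}\,(\mathtt{Record}^*S)\,\vec C\leadsto C_R\,S\,(\mathsf{Rmap}\,(\lambda\alpha{:}\mathit{Type}.\mathsf{Typerec}\,\alpha\,\vec C)\,S)$, $\mathsf{Typerec}\,(\mathtt{Trace}^*D)\,\vec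 C\leadsto C_T\,D\,(\mathsf{Typerec}\,D\,\vec C)$. **Equivalence.** $\Gamma\vdash C=D:K$ is the kinded congruent equivalence relation on constructors and row constructors that contains $C=D:K$ whenever $C\leadsto D$ and both have kind $K$, and $\lambda\alpha{:}K.C\,\alpha=C:K\to K'$ for $C:K\to K'$. $\Gamma\vdash A=B:K$ is the kinded congruent equivalence relation on types and row types that contains $\mathtt T(C)=\mathtt T(D)$ for $C=D$ at kind $\mathit{Type}$ or $\mathit{BaseType}$, $\mathtt T(S)=\mathtt T(S')$ for $S=S'$ at kind $\mathit{Row}$ or $\mathit{BaseRow}$, $\mathtt T(\mathtt{Bool}^*)=\mathtt{Bool}$, $\mathtt T(\mathtt{Int}^*)=\mathtt{Int}$, $\mathtt T(\mathtt{String}^*)=\mathtt{String}$, $\mathtt T(\mathtt{List}^*C)=\mathtt{List}\,\mathtt T(C)$, $\mathtt T(\mathtt{Record}^*S)=\mathtt{Record}\,\mathtt T(S)$, $\mathtt T(\mathtt{Trace}^*C)=\mathtt{Trace}\,\mathtt T(C)$, $\mathtt T(\cdot)=\cdot$, $\mathtt T(l{:}C;S)=(l{:}\mathtt T(C);\mathtt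 T(S))$, for well-kinded arguments. **Typing** $\Gamma\vdash M:A$. Let $\mathtt{TRACE}=\lambda\alpha{:}\mathit{Type}.\mathsf{Typerec}\,\alpha\,(\mathtt{Trace}^*\mathtt{Bool}^*,\mathtt{Trace}^*\mathtt{Int}^*,\mathtt{Trace}^*\mathtt{String}^*,\lambda\_{:}\mathit{Type}.\lambda\beta{:}\mathit{Type}.\mathtt{List}^*\beta,\lambda\_{:}\mathit{Row}.\lambda\rho{:}\mathit{Row}.\mathtt{Record}^*\rho,\lambda\_{:}\mathit{BaseType}.\lambda\beta{:}\mathit{Type}.\beta)$. The rules are: literals have type $\mathtt{Bool}$, $\mathtt{Int}$ or $\mathtt{String}$; variables have their type in $\Gamma$; $\lambda x{:}A.M:A\to B$ if $A:\mathit{Type}$ and $\Gamma,x{:}A\vdash M:B$; $M\,N:B$ if $M:A\to B$, $N:A$; $\Lambda\alpha{:}K.M:\forall\alpha{:}K.A$ if $\Gamma,\alpha{:}K\vdash M:A$; $M\,C:A[\alpha:=C]$ if $M:\forall\alpha{:}K.A$ and $C:K$ (with a row constructor $S$ for $C$ if $K$ is $\mathit{Row}$ or $\mathit{BaseRow}$);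 $\mathsf{fix}\,f{:}A.M:A$ if $A:\mathit{Type}$ and $\Gamma,f{:}A\vdash M:A$; $\mathsf{if}\,L\,\mathsf{then}\,M\,\mathsf{else}\,N:A$ if $L:\mathtt{Bool}$, $M:A$, $N:A$; $M+N:\mathtt{Int}$ if $M,N:\mathtt{Int}$; $M==N:\mathtt{Bool}$ if $M,N:A$ and $A:\mathit{BaseType}$; $\mathsf{table}\,n\,\langle\mathsf{oid}{:}\mathtt{Int};R\rangle:\mathtt{List}\langle\mathsf{oid}{:}\mathtt{Int};R\rangle$ if $\cdot\vdash R:\mathit{BaseRow}$; $[]:\mathtt{List}\,A$ if $A:\mathit{Type}$; $[M]:\mathtt{List}\,A$ if $M:A$; $M\mathbin{+\!\!+}N:\mathtt{List}\,A$ if $M,N:\mathtt{List}\,A$; $\mathsf{for}\,(x\leftarrow M)\,N:\mathtt{List}\,B$ if $M:\mathtt{List}\,A$ and $\Gamma,x{:}A\vdash N:\mathtt{List}\,B$; $\langle\rangle:\langle\cdot\rangle$ if $\Gamma$ is well formed; $\langle l=M;N\rangle:\langle l{:}A;R\rangle$ if $M:A$, $N:\langle R\rangle$; $M.l:A$ if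 $M:\langle l{:}A;R\rangle$; $M:A$ if $M:B$ and $\Gamma\vdash A=B:\mathit{Type}$; $\mathsf{rmap}^S\,M\,N:\mathtt T(\mathtt{Record}^*(\mathsf{Rmap}\,C\,S))$ if $S:\mathit{Row}$, $M:\forall\alpha{:}\mathit{Type}.\mathtt T(\alpha)\to\mathtt T(C\,\alpha)$, $N:\mathtt T(\mathtt{Record}^*S)$; $\mathsf{rfold}^S\,L\,M\,N:\mathtt T(C)$ if $S:\mathit{Row}$, $L:\mathtt T(C)\to\mathtt T(C)\to\mathtt T(C)$, $M:\mathtt T(C)$, $N:\mathtt T(\mathtt{Record}^*(\mathsf{Rmap}\,(\lambda\alpha{:}\mathit{Type}.C)\,S))$, $\alpha$ not free in $C$; $\mathsf{typecase}\,C\,\mathsf{of}\,(M_B,M_I,M_S,\beta.M_L,\rho.M_R,\gamma.M_T):B[\alpha:=C]$ if $C:\mathit{Type}$, $\Gamma,\alpha{:}\mathit{Type}\vdash B:\mathit{Type}$, $\Gamma\vdash M_B:B[\alpha:=\mathtt{Bool}^*]$, $\Gamma\vdash M_I:B[\alpha:=\mathtt{Int}^*]$, $\Gamma\vdash M_S:B[\alpha:=\mathtt{String}^*]$,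 $\Gamma,\beta{:}\mathit{Type}\vdash M_L:B[\alpha:=\mathtt{List}^*\beta]$, $\Gamma,\rho{:}\mathit{Row}\vdash M_R:B[\alpha:=\mathtt{Record}^*\rho]$, $\Gamma,\gamma{:}\mathit{BaseType}\vdash M_T:B[\alpha:=\mathtt{Trace}^*\gamma]$. For traces put $I_A=\langle\mathsf{cond}{:}\mathtt{Trace\,Bool};\mathsf{out}{:}\mathtt{Trace}\,A\rangle$, $F_{C,A}=\langle\mathsf{in}{:}\mathtt T(\mathtt{TRACE}\,C);\mathsf{out}{:}\mathtt{Trace}\,A\rangle$, $L_A=\langle\mathsf{table}{:}\mathtt{String};\mathsf{column}{:}\mathtt{String};\mathsf{row}{:}\mathtt{Int};\mathsf{data}{:}A\rangle$, $O_A=\langle\mathsf{left}{:}A;\mathsf{right}{:}A\rangle$. Then $\mathtt{Lit}\,M:\mathtt{Trace}\,A$ if $M:A$ and $A$ is $\mathtt{Bool}$, $\mathtt{Int}$ or $\mathtt{String}$; $\mathtt{If}\,M:\mathtt{Trace}\,A$ if $M:I_A$; $\mathtt{For}\,C\,M:\mathtt{Trace}\,A$ if $C:\mathit{Type}$, $M:F_{C,A}$;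 $\mathtt{Cell}\,M:\mathtt{Trace}\,A$ if $M:L_A$; $\mathtt{OpEq}\,C\,M:\mathtt{Trace\,Bool}$ if $C:\mathit{BaseType}$, $M:O_{\mathtt T(\mathtt{TRACE}\,C)}$; $\mathtt{OpPlus}\,M:\mathtt{Trace\,Int}$ if $M:O_{\mathtt{Trace\,Int}}$; $\mathsf{tracecase}\,M\,\mathsf{of}\,(x.M_L,x.M_I,\alpha.x.M_F,x.M_C,\alpha.x.M_E,x.M_P):B$ if $M:\mathtt{Trace}\,A$ and $M_L$, $M_I$, $M_F$, $M_C$, $M_E$, $M_P$ have type $B$ in $\Gamma$ extended by, respectively, $x{:}A$; $x{:}I_A$; $\alpha{:}\mathit{Type},x{:}F_{\alpha,A}$; $x{:}L_A$; $\alpha{:}\mathit{BaseType},x{:}O_{\mathtt T(\mathtt{TRACE}\,\alpha)}$; $x{:}O_{\mathtt{Trace\,Int}}$. **Term reduction** $\leadsto$ is the least relation that contains the rules (1) and (2) below and is closed under reduction of any immediate subterm (also under binders and in branches), except the body of a $\mathsf{fix}$, and under constructor reduction of the constructor or row constructor immediately inside $M\,C$, $M\,S$, $\mathsf{rmap}^S$,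 $\mathsf{rfold}^S$, $\mathtt{For}\,C\,M$, $\mathtt{OpEq}\,C\,M$ and $\mathsf{typecase}\,C$. (1) $\beta$-rules: $(\lambda x{:}A.M)\,N\leadsto M[x:=N]$; $\mathsf{fix}\,f{:}A.M\leadsto M[f:=\mathsf{fix}\,f{:}A.M]$; $(\Lambda\alpha{:}K.M)\,C\leadsto M[\alpha:=C]$ (likewise for row constructors); $\mathsf{if}\,\mathsf{true}\,\mathsf{then}\,M\,\mathsf{else}\,N\leadsto M$; $\mathsf{if}\,\mathsf{false}\,\mathsf{then}\,M\,\mathsf{else}\,N\leadsto N$; $\langle l_1=M_1;\dots;l_n=M_n;N\rangle.l_i\leadsto M_i$ if $l_j\ne l_i$ for $j<i$ ($N$ arbitrary); $\mathsf{rmap}^{(l_1:C_1;\dots;l_n:C_n;\cdot)}\,M\,N\leadsto\langle l_1=(M\,C_1)\,N.l_1;\dots;l_n=(M\,C_n)\,N.l_n\rangle$; $\mathsf{rfold}^{(l_1:C_1;\dots;l_n:C_n;\cdot)}\,L\,M\,N\leadsto L\,N.l_1\,(L\,N.l_2\cdots(L\,N.l_n\,M)\cdots)$; $\mathsf{for}\,(x\leftarrow[])\,N\leadsto[]$;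 $\mathsf{for}\,(x\leftarrow[M])\,N\leadsto N[x:=M]$; $\mathsf{tracecase}$ applied to $\mathtt{Lit}\,M$, $\mathtt{If}\,M$, $\mathtt{For}\,C\,M$, $\mathtt{Cell}\,M$, $\mathtt{OpEq}\,C\,M$, $\mathtt{OpPlus}\,M$ reduces to $M_L[x:=M]$, $M_I[x:=M]$, $M_F[\alpha:=C,x:=M]$, $M_C[x:=M]$, $M_E[\alpha:=C,x:=M]$, $M_P[x:=M]$; $\mathsf{typecase}$ applied to $\mathtt{Bool}^*$, $\mathtt{Int}^*$, $\mathtt{String}^*$, $\mathtt{List}^*C$, $\mathtt{Record}^*S$, $\mathtt{Trace}^*C$ reduces to $M_B$, $M_I$, $M_S$, $M_L[\beta:=C]$, $M_R[\rho:=S]$, $M_T[\gamma:=C]$. (2) Commuting conversions: $E[\mathsf{if}\,L\,\mathsf{then}\,M_1\,\mathsf{else}\,M_2]\leadsto\mathsf{if}\,L\,\mathsf{then}\,E[M_1]\,\mathsf{else}\,E[M_2]$ for $E$ one of $\square\,N$, $\square\,C$, $\square\,S$, $\square.l$, $\mathsf{if}\,\square\,\mathsf{then}\,N_1\,\mathsf{else}\,N_2$,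 $\mathsf{for}\,(x\leftarrow\square)\,N$, $\mathsf{tracecase}\,\square\,\mathsf{of}\,(\dots)$; $\mathsf{for}\,(x\leftarrow M_1\mathbin{+\!\!+}M_2)\,N\leadsto(\mathsf{for}\,(x\leftarrow M_1)\,N)\mathbin{+\!\!+}(\mathsf{for}\,(x\leftarrow M_2)\,N)$; $\mathsf{for}\,(x\leftarrow\mathsf{for}\,(y\leftarrow L)\,M)\,N\leadsto\mathsf{for}\,(y\leftarrow L)\,\mathsf{for}\,(x\leftarrow M)\,N$. **LinksT normal form.** $M$ is in LinksT normal form if it is generated by the nonterminal for normal terms in the following grammar (in which $C,D$, $S$, $L,M,N$ and all branches stand for normal constructors, row constructors and terms, while types $A$ and row types $R$ are arbitrary): - Normal constructors $C,D ::= E\mid\mathtt{Bool}^*\mid\mathtt{Int}^*\mid\mathtt{String}^*\mid\lambda\alpha{:}K.C\mid\mathtt{List}^*C\mid\mathtt{Record}^*S\mid\mathtt{Trace}^*C$ - Neutral constructors $E ::= \alpha\mid E\,C\mid E\,S\mid\mathsf{Typerec}\,E\,(C_B,C_I,C_S,C_L,C_R,C_T)$ - Normal row constructors $S ::= \cdot\mid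 l:C;S\mid U$ - Neutral row constructors $U ::= \rho\mid l:C;U\mid\mathsf{Rmap}\,C\,U$ - Normal terms $L,M,N ::= F\mid c\mid\lambda x{:}A.M\mid\Lambda\alpha{:}K.M\mid\mathsf{if}\,H\,\mathsf{then}\,M\,\mathsf{else}\,N\mid M+N\mid M==N\mid\langle\rangle\mid\langle l=M;N\rangle\mid\mathsf{rmap}^U\,M\,N\mid[]\mid[M]\mid M\mathbin{+\!\!+}N\mid\mathsf{for}\,(x\leftarrow T)\,N\mid\mathsf{table}\,n\,\langle R\rangle\mid\mathtt{Lit}\,M\mid\mathtt{If}\,M\mid\mathtt{For}\,C\,M\mid\mathtt{Cell}\,M\mid\mathtt{OpEq}\,C\,M\mid\mathtt{OpPlus}\,M$ - Neutral terms $F ::= x\mid P.l\mid F\,M\mid F\,C\mid F\,S\mid\mathsf{rfold}^U\,L\,M\,N\mid\mathsf{tracecase}\,F\,\mathsf{of}\,(x.M_L,x.M_I,\alpha.x.M_F,x.M_C,\alpha.x.M_E,x.M_P)\mid\mathsf{typecase}\,E\,\mathsf{of}\,(M_B,M_I,M_S,\beta.M_L,\rho.M_R,\gamma.M_T)$ -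 Neutral conditionals $H ::= F\mid M==N$; neutral projections $P ::= F\mid\mathsf{rmap}^U\,M\,N$; neutral tables $T ::= F\mid\mathsf{table}\,n\,\langle R\rangle$ -/

import Mathlib

/-! The calculus LinksT: syntax, kinding, equivalence, typing, reduction and normal forms.

Binding is represented by de Bruijn indices, so that terms are taken up to renaming of bound
variables.  Type and row variables are indexed separately from term variables; accordingly a
context is a pair of a list `Δ` of kinds and a list `Γ` of types over `Δ`.  Freshness side
conditions are then automatic. -/

namespace LinksT

/-- Record labels; the labels that the rules mention by name are listed separately. -/
inductive Label : Type
  | oid | cond | out | input | table | column | row | data | left | right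
  | name (s : String)
  deriving DecidableEq

/-- The two syntactic sorts: (type) constructors and types, row constructors and row types. -/
inductive Srt : Type
  | con | row
  deriving DecidableEq

inductive Kind : Type
  | type | baseType | row | baseRow
  | arr (K₁ K₂ : Kind)
  deriving DecidableEq

/-- The sort of the variables of a given kind: the variables of kind `Row` or `BaseRow` are the
row variables `ρ`. -/
def Kind.srt : Kind → Srt
  | .row => .row
  | .baseRow => .row
  | _ => .con

/-- Constructors `C`, `D` are the elements of `Con .con`, row constructors `S` those of
`Con .row`.  Type-level functions may be applied to either. -/
inductive Con : Srt → Type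
  | var (s : Srt) (n : ℕ) : Con s
  | bool : Con .con
  | int : Con .con
  | str : Con .con
  | lam (K : Kind) (C : Con .con) : Con .con
  | app {s : Srt} (C : Con .con) (D : Con s) : Con .con
  | list (C : Con .con) : Con .con
  | record (S : Con .row) : Con .con
  | trace (C : Con .con) : Con .con
  | typerec (C CB CI CS CL CR CT : Con .con) : Con .con
  | nil : Con .row
  | cons (l : Label) (C : Con .con) (S : Con .row) : Con .row
  | rmap (C : Con .con) (S : Con .row) : Con .row

/-- Types `A`, `B` are the elements of `Ty .con`, row types `R` those of `Ty .row`. -/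
inductive Ty : Srt → Type
  | T {s : Srt} (C : Con s) : Ty s
  | bool : Ty .con
  | int : Ty .con
  | str : Ty .con
  | fn (A B : Ty .con) : Ty .con
  | list (A : Ty .con) : Ty .con
  | record (R : Ty .row) : Ty .con
  | trace (A : Ty .con) : Ty .con
  | all (K : Kind) (A : Ty .con) : Ty .con
  | nil : Ty .row
  | cons (l : Label) (A : Ty .con) (R : Ty .row) : Ty .row

inductive Const : Type
  | bool (b : Bool)
  | int (i : ℤ)
  | str (s : String)

/-- Terms.  `lam`, `fix` and the body of `for` bind one term variable, `tlam` binds a type or row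
variable.  In `tracecase`, every branch binds a term variable, and `MF`, `ME` also bind a type
variable; in `typecase`, the branches `ML`, `MR`, `MT` bind a type or row variable. -/
inductive Tm : Type
  | const (c : Const)
  | var (n : ℕ)
  | lam (A : Ty .con) (M : Tm)
  | app (M N : Tm)
  | tlam (K : Kind) (M : Tm)
  | tapp {s : Srt} (M : Tm) (C : Con s)
  | fix (A : Ty .con) (M : Tm)
  | ite (L M N : Tm)
  | plus (M N : Tm)
  | eq (M N : Tm)
  | unit
  | ext (l : Label) (M N : Tm)
  | proj (M : Tm) (l : Label)
  | rmap (S : Con .row) (M N : Tm)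
  | rfold (S : Con .row) (L M N : Tm)
  | nil
  | single (M : Tm)
  | append (M N : Tm)
  | for (M N : Tm)
  | table (n : String) (R : Ty .row)
  | trLit (M : Tm)
  | trIf (M : Tm)
  | trFor (C : Con .con) (M : Tm)
  | trCell (M : Tm)
  | trOpEq (C : Con .con) (M : Tm)
  | trOpPlus (M : Tm)
  | tracecase (M ML MI MF MC ME MP : Tm)
  | typecase (C : Con .con) (MB MI MS ML MR MT : Tm)

/-! ### Renaming and substitution -/

def liftRen (ξ : ℕ → ℕ) : ℕ → ℕ
  | 0 => 0
  | n + 1 => ξ n + 1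

def Con.ren : {s : Srt} → (ℕ → ℕ) → Con s → Con s
  | _, ξ, .var s n => .var s (ξ n)
  | _, _, .bool => .bool
  | _, _, .int => .int
  | _, _, .str => .str
  | _, ξ, .lam K C => .lam K (C.ren (liftRen ξ))
  | _, ξ, .app C D => .app (C.ren ξ) (D.ren ξ)
  | _, ξ, .list C => .list (C.ren ξ)
  | _, ξ, .record S => .record (S.ren ξ)
  | _, ξ, .trace C => .trace (C.ren ξ)
  | _, ξ, .typerec C CB CI CS CL CR CT =>
      .typerec (C.ren ξ) (CB.ren ξ) (CI.ren ξ) (CS.ren ξ) (CL.ren ξ) (CR.ren ξ) (CT.ren ξ)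
  | _, _, .nil => .nil
  | _, ξ, .cons l C S => .cons l (C.ren ξ) (S.ren ξ)
  | _, ξ, .rmap C S => .rmap (C.ren ξ) (S.ren ξ)

/-- Weakening by one type or row variable. -/
abbrev Con.wk {s : Srt} (C : Con s) : Con s := C.ren Nat.succ

/-- Simultaneous substitutions for type and row variables. -/
abbrev TSub : Type := (s : Srt) → ℕ → Con s

def TSub.lift (σ : TSub) : TSub := fun s n =>
  match n with
  | 0 => .var s 0
  | n + 1 => (σ s n).wk

/-- The substitution `[α := D]` for the last bound variable.  A constructor replaces a type
variable and a row constructor replaces a row variable; an occurrence of index `0` at the other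
sort never arises in well-kinded expressions and is left alone. -/
def TSub.inst {s' : Srt} (D : Con s') : TSub := fun s n =>
  match n with
  | 0 => if h : s' = s then h ▸ D else .var s 0
  | n + 1 => .var s n

def Con.subst : {s : Srt} → TSub → Con s → Con s
  | _, σ, .var s n => σ s n
  | _, _, .bool => .bool
  | _, _, .int => .int
  | _, _, .str => .str
  | _, σ, .lam K C => .lam K (C.subst σ.lift)
  | _, σ, .app C D => .app (C.subst σ) (D.subst σ)
  | _, σ, .list C => .list (C.subst σ)
  | _, σ, .record S => .record (S.subst σ)
  | _, σ, .trace C => .trace (C.subst σ)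
  | _, σ, .typerec C CB CI CS CL CR CT =>
      .typerec (C.subst σ) (CB.subst σ) (CI.subst σ) (CS.subst σ) (CL.subst σ) (CR.subst σ)
        (CT.subst σ)
  | _, _, .nil => .nil
  | _, σ, .cons l C S => .cons l (C.subst σ) (S.subst σ)
  | _, σ, .rmap C S => .rmap (C.subst σ) (S.subst σ)

def Ty.ren : {s : Srt} → (ℕ → ℕ) → Ty s → Ty s
  | _, ξ, .T C => .T (C.ren ξ)
  | _, _, .bool => .bool
  | _, _, .int => .int
  | _, _, .str => .str
  | _, ξ, .fn A B => .fn (A.ren ξ) (B.ren ξ)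
  | _, ξ, .list A => .list (A.ren ξ)
  | _, ξ, .record R => .record (R.ren ξ)
  | _, ξ, .trace A => .trace (A.ren ξ)
  | _, ξ, .all K A => .all K (A.ren (liftRen ξ))
  | _, _, .nil => .nil
  | _, ξ, .cons l A R => .cons l (A.ren ξ) (R.ren ξ)

abbrev Ty.wk {s : Srt} (A : Ty s) : Ty s := A.ren Nat.succ

def Ty.subst : {s : Srt} → TSub → Ty s → Ty s
  | _, σ, .T C => .T (C.subst σ)
  | _, _, .bool => .bool
  | _, _, .int => .int
  | _, _, .str => .str
  | _, σ, .fn A B => .fn (A.subst σ) (B.subst σ)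
  | _, σ, .list A => .list (A.subst σ)
  | _, σ, .record R => .record (R.subst σ)
  | _, σ, .trace A => .trace (A.subst σ)
  | _, σ, .all K A => .all K (A.subst σ.lift)
  | _, _, .nil => .nil
  | _, σ, .cons l A R => .cons l (A.subst σ) (R.subst σ)

/-- Renaming of type and row variables in terms. -/
def Tm.tren : (ℕ → ℕ) → Tm → Tm
  | _, .const c => .const c
  | _, .var n => .var n
  | ξ, .lam A M => .lam (A.ren ξ) (M.tren ξ)
  | ξ, .app M N => .app (M.tren ξ) (N.tren ξ)
  | ξ, .tlam K M => .tlam K (M.tren (liftRen ξ))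
  | ξ, .tapp M C => .tapp (M.tren ξ) (C.ren ξ)
  | ξ, .fix A M => .fix (A.ren ξ) (M.tren ξ)
  | ξ, .ite L M N => .ite (L.tren ξ) (M.tren ξ) (N.tren ξ)
  | ξ, .plus M N => .plus (M.tren ξ) (N.tren ξ)
  | ξ, .eq M N => .eq (M.tren ξ) (N.tren ξ)
  | _, .unit => .unit
  | ξ, .ext l M N => .ext l (M.tren ξ) (N.tren ξ)
  | ξ, .proj M l => .proj (M.tren ξ) l
  | ξ, .rmap S M N => .rmap (S.ren ξ) (M.tren ξ) (N.tren ξ)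
  | ξ, .rfold S L M N => .rfold (S.ren ξ) (L.tren ξ) (M.tren ξ) (N.tren ξ)
  | _, .nil => .nil
  | ξ, .single M => .single (M.tren ξ)
  | ξ, .append M N => .append (M.tren ξ) (N.tren ξ)
  | ξ, .for M N => .for (M.tren ξ) (N.tren ξ)
  | ξ, .table n R => .table n (R.ren ξ)
  | ξ, .trLit M => .trLit (M.tren ξ)
  | ξ, .trIf M => .trIf (M.tren ξ)
  | ξ, .trFor C M => .trFor (C.ren ξ) (M.tren ξ)
  | ξ, .trCell M => .trCell (M.tren ξ)
  | ξ, .trOpEq C M => .trOpEq (C.ren ξ) (M.tren ξ)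
  | ξ, .trOpPlus M => .trOpPlus (M.tren ξ)
  | ξ, .tracecase M ML MI MF MC ME MP =>
      .tracecase (M.tren ξ) (ML.tren ξ) (MI.tren ξ) (MF.tren (liftRen ξ)) (MC.tren ξ)
        (ME.tren (liftRen ξ)) (MP.tren ξ)
  | ξ, .typecase C MB MI MS ML MR MT =>
      .typecase (C.ren ξ) (MB.tren ξ) (MI.tren ξ) (MS.tren ξ) (ML.tren (liftRen ξ))
        (MR.tren (liftRen ξ)) (MT.tren (liftRen ξ))

/-- Substitution for type and row variables in terms. -/
def Tm.tsubst : TSub → Tm → Tm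
  | _, .const c => .const c
  | _, .var n => .var n
  | σ, .lam A M => .lam (A.subst σ) (M.tsubst σ)
  | σ, .app M N => .app (M.tsubst σ) (N.tsubst σ)
  | σ, .tlam K M => .tlam K (M.tsubst σ.lift)
  | σ, .tapp M C => .tapp (M.tsubst σ) (C.subst σ)
  | σ, .fix A M => .fix (A.subst σ) (M.tsubst σ)
  | σ, .ite L M N => .ite (L.tsubst σ) (M.tsubst σ) (N.tsubst σ)
  | σ, .plus M N => .plus (M.tsubst σ) (N.tsubst σ)
  | σ, .eq M N => .eq (M.tsubst σ) (N.tsubst σ)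
  | _, .unit => .unit
  | σ, .ext l M N => .ext l (M.tsubst σ) (N.tsubst σ)
  | σ, .proj M l => .proj (M.tsubst σ) l
  | σ, .rmap S M N => .rmap (S.subst σ) (M.tsubst σ) (N.tsubst σ)
  | σ, .rfold S L M N => .rfold (S.subst σ) (L.tsubst σ) (M.tsubst σ) (N.tsubst σ)
  | _, .nil => .nil
  | σ, .single M => .single (M.tsubst σ)
  | σ, .append M N => .append (M.tsubst σ) (N.tsubst σ)
  | σ, .for M N => .for (M.tsubst σ) (N.tsubst σ)
  | σ, .table n R => .table n (R.subst σ)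
  | σ, .trLit M => .trLit (M.tsubst σ)
  | σ, .trIf M => .trIf (M.tsubst σ)
  | σ, .trFor C M => .trFor (C.subst σ) (M.tsubst σ)
  | σ, .trCell M => .trCell (M.tsubst σ)
  | σ, .trOpEq C M => .trOpEq (C.subst σ) (M.tsubst σ)
  | σ, .trOpPlus M => .trOpPlus (M.tsubst σ)
  | σ, .tracecase M ML MI MF MC ME MP =>
      .tracecase (M.tsubst σ) (ML.tsubst σ) (MI.tsubst σ) (MF.tsubst σ.lift) (MC.tsubst σ)
        (ME.tsubst σ.lift) (MP.tsubst σ)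
  | σ, .typecase C MB MI MS ML MR MT =>
      .typecase (C.subst σ) (MB.tsubst σ) (MI.tsubst σ) (MS.tsubst σ) (ML.tsubst σ.lift)
        (MR.tsubst σ.lift) (MT.tsubst σ.lift)

/-- Renaming of term variables. -/
def Tm.ren : (ℕ → ℕ) → Tm → Tm
  | _, .const c => .const c
  | ξ, .var n => .var (ξ n)
  | ξ, .lam A M => .lam A (M.ren (liftRen ξ))
  | ξ, .app M N => .app (M.ren ξ) (N.ren ξ)
  | ξ, .tlam K M => .tlam K (M.ren ξ)
  | ξ, .tapp M C => .tapp (M.ren ξ) C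
  | ξ, .fix A M => .fix A (M.ren (liftRen ξ))
  | ξ, .ite L M N => .ite (L.ren ξ) (M.ren ξ) (N.ren ξ)
  | ξ, .plus M N => .plus (M.ren ξ) (N.ren ξ)
  | ξ, .eq M N => .eq (M.ren ξ) (N.ren ξ)
  | _, .unit => .unit
  | ξ, .ext l M N => .ext l (M.ren ξ) (N.ren ξ)
  | ξ, .proj M l => .proj (M.ren ξ) l
  | ξ, .rmap S M N => .rmap S (M.ren ξ) (N.ren ξ)
  | ξ, .rfold S L M N => .rfold S (L.ren ξ) (M.ren ξ) (N.ren ξ)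
  | _, .nil => .nil
  | ξ, .single M => .single (M.ren ξ)
  | ξ, .append M N => .append (M.ren ξ) (N.ren ξ)
  | ξ, .for M N => .for (M.ren ξ) (N.ren (liftRen ξ))
  | _, .table n R => .table n R
  | ξ, .trLit M => .trLit (M.ren ξ)
  | ξ, .trIf M => .trIf (M.ren ξ)
  | ξ, .trFor C M => .trFor C (M.ren ξ)
  | ξ, .trCell M => .trCell (M.ren ξ)
  | ξ, .trOpEq C M => .trOpEq C (M.ren ξ)
  | ξ, .trOpPlus M => .trOpPlus (M.ren ξ)
  | ξ, .tracecase M ML MI MF MC ME MP =>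
      .tracecase (M.ren ξ) (ML.ren (liftRen ξ)) (MI.ren (liftRen ξ)) (MF.ren (liftRen ξ))
        (MC.ren (liftRen ξ)) (ME.ren (liftRen ξ)) (MP.ren (liftRen ξ))
  | ξ, .typecase C MB MI MS ML MR MT =>
      .typecase C (MB.ren ξ) (MI.ren ξ) (MS.ren ξ) (ML.ren ξ) (MR.ren ξ) (MT.ren ξ)

/-- A term substitution under a binder of a term variable. -/
def liftSub (τ : ℕ → Tm) : ℕ → Tm
  | 0 => .var 0
  | n + 1 => (τ n).ren Nat.succ

/-- A term substitution under a binder of a type or row variable. -/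
def tliftSub (τ : ℕ → Tm) : ℕ → Tm := fun n => (τ n).tren Nat.succ

/-- Substitution for term variables. -/
def Tm.subst : (ℕ → Tm) → Tm → Tm
  | _, .const c => .const c
  | τ, .var n => τ n
  | τ, .lam A M => .lam A (M.subst (liftSub τ))
  | τ, .app M N => .app (M.subst τ) (N.subst τ)
  | τ, .tlam K M => .tlam K (M.subst (tliftSub τ))
  | τ, .tapp M C => .tapp (M.subst τ) C
  | τ, .fix A M => .fix A (M.subst (liftSub τ))
  | τ, .ite L M N => .ite (L.subst τ) (M.subst τ) (N.subst τ)
  | τ, .plus M N => .plus (M.subst τ) (N.subst τ)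
  | τ, .eq M N => .eq (M.subst τ) (N.subst τ)
  | _, .unit => .unit
  | τ, .ext l M N => .ext l (M.subst τ) (N.subst τ)
  | τ, .proj M l => .proj (M.subst τ) l
  | τ, .rmap S M N => .rmap S (M.subst τ) (N.subst τ)
  | τ, .rfold S L M N => .rfold S (L.subst τ) (M.subst τ) (N.subst τ)
  | _, .nil => .nil
  | τ, .single M => .single (M.subst τ)
  | τ, .append M N => .append (M.subst τ) (N.subst τ)
  | τ, .for M N => .for (M.subst τ) (N.subst (liftSub τ))
  | _, .table n R => .table n R
  | τ, .trLit M => .trLit (M.subst τ)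
  | τ, .trIf M => .trIf (M.subst τ)
  | τ, .trFor C M => .trFor C (M.subst τ)
  | τ, .trCell M => .trCell (M.subst τ)
  | τ, .trOpEq C M => .trOpEq C (M.subst τ)
  | τ, .trOpPlus M => .trOpPlus (M.subst τ)
  | τ, .tracecase M ML MI MF MC ME MP =>
      .tracecase (M.subst τ) (ML.subst (liftSub τ)) (MI.subst (liftSub τ))
        (MF.subst (liftSub (tliftSub τ))) (MC.subst (liftSub τ))
        (ME.subst (liftSub (tliftSub τ))) (MP.subst (liftSub τ))
  | τ, .typecase C MB MI MS ML MR MT =>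
      .typecase C (MB.subst τ) (MI.subst τ) (MS.subst τ) (ML.subst (tliftSub τ))
        (MR.subst (tliftSub τ)) (MT.subst (tliftSub τ))

/-- `C[α := D]`, for the last bound type or row variable. -/
abbrev Con.inst {s s' : Srt} (C : Con s) (D : Con s') : Con s := C.subst (TSub.inst D)

/-- `A[α := D]`, for the last bound type or row variable. -/
abbrev Ty.inst {s s' : Srt} (A : Ty s) (D : Con s') : Ty s := A.subst (TSub.inst D)

/-- `M[α := D]`, for the last bound type or row variable. -/
abbrev Tm.tinst {s' : Srt} (M : Tm) (D : Con s') : Tm := M.tsubst (TSub.inst D)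

/-- `M[x := N]`, for the last bound term variable. -/
def Tm.inst (M N : Tm) : Tm :=
  M.subst fun n => match n with
    | 0 => N
    | n + 1 => .var n

/-! ### Kinding -/

/-- Subkinding generated by `BaseType ≤ Type` and `BaseRow ≤ Row`. -/
inductive Subkind : Kind → Kind → Prop
  | refl (K : Kind) : Subkind K K
  | baseType : Subkind .baseType .type
  | baseRow : Subkind .baseRow .row
  | arr {K₁ K₁' K₂ K₂' : Kind} :
      Subkind K₁' K₁ → Subkind K₂ K₂' → Subkind (.arr K₁ K₂) (.arr K₁' K₂')

/-- Kinding `Δ ⊢ C : K` and `Δ ⊢ S : K` of constructors and row constructors. -/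
inductive HasKind : List Kind → {s : Srt} → Con s → Kind → Prop
  | sub {Δ} {s : Srt} {C : Con s} {K K' : Kind} :
      HasKind Δ C K → Subkind K K' → HasKind Δ C K'
  | bool {Δ} : HasKind Δ .bool .baseType
  | int {Δ} : HasKind Δ .int .baseType
  | str {Δ} : HasKind Δ .str .baseType
  | var {Δ : List Kind} {s : Srt} {n : ℕ} {K : Kind} :
      Δ[n]? = some K → s = K.srt → HasKind Δ (.var s n) K
  | lam {Δ} {K₁ K₂ : Kind} {C : Con .con} :
      HasKind (K₁ :: Δ) C K₂ → HasKind Δ (.lam K₁ C) (.arr K₁ K₂)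
  | app {Δ} {s : Srt} {K₁ K₂ : Kind} {C : Con .con} {D : Con s} :
      HasKind Δ C (.arr K₁ K₂) → s = K₁.srt → HasKind Δ D K₁ → HasKind Δ (.app C D) K₂
  | list {Δ} {C : Con .con} : HasKind Δ C .type → HasKind Δ (.list C) .type
  | record {Δ} {S : Con .row} : HasKind Δ S .row → HasKind Δ (.record S) .type
  | trace {Δ} {C : Con .con} : HasKind Δ C .baseType → HasKind Δ (.trace C) .type
  | typerec {Δ} {K : Kind} {C CB CI CS CL CR CT : Con .con} :
      HasKind Δ C .type → HasKind Δ CB K → HasKind Δ CI K → HasKind Δ CS K →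
      HasKind Δ CL (.arr .type (.arr K K)) →
      HasKind Δ CR (.arr .row (.arr .row K)) →
      HasKind Δ CT (.arr .baseType (.arr K K)) →
      HasKind Δ (.typerec C CB CI CS CL CR CT) K
  | nil {Δ} : HasKind Δ .nil .row
  | nilBase {Δ} : HasKind Δ .nil .baseRow
  | cons {Δ} {l : Label} {C : Con .con} {S : Con .row} :
      HasKind Δ C .type → HasKind Δ S .row → HasKind Δ (.cons l C S) .row
  | consBase {Δ} {l : Label} {C : Con .con} {S : Con .row} :
      HasKind Δ C .baseType → HasKind Δ S .baseRow → HasKind Δ (.cons l C S) .baseRow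
  | rmap {Δ} {C : Con .con} {S : Con .row} :
      HasKind Δ C (.arr .type .type) → HasKind Δ S .row → HasKind Δ (.rmap C S) .row

/-- Kinding `Δ ⊢ A : K` and `Δ ⊢ R : K` of types and row types. -/
inductive TyKind : List Kind → {s : Srt} → Ty s → Kind → Prop
  | sub {Δ} {s : Srt} {A : Ty s} {K K' : Kind} : TyKind Δ A K → Subkind K K' → TyKind Δ A K'
  | T {Δ} {C : Con .con} : HasKind Δ C .type → TyKind Δ (.T C) .type
  | TBase {Δ} {C : Con .con} : HasKind Δ C .baseType → TyKind Δ (.T C) .baseType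
  | bool {Δ} : TyKind Δ .bool .baseType
  | int {Δ} : TyKind Δ .int .baseType
  | str {Δ} : TyKind Δ .str .baseType
  | all {Δ} {K : Kind} {A : Ty .con} : TyKind (K :: Δ) A .type → TyKind Δ (.all K A) .type
  | fn {Δ} {A B : Ty .con} : TyKind Δ A .type → TyKind Δ B .type → TyKind Δ (.fn A B) .type
  | list {Δ} {A : Ty .con} : TyKind Δ A .type → TyKind Δ (.list A) .type
  | record {Δ} {R : Ty .row} : TyKind Δ R .row → TyKind Δ (.record R) .type
  | trace {Δ} {A : Ty .con} : TyKind Δ A .baseType → TyKind Δ (.trace A) .type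
  | TRow {Δ} {S : Con .row} : HasKind Δ S .row → TyKind Δ (.T S) .row
  | TBaseRow {Δ} {S : Con .row} : HasKind Δ S .baseRow → TyKind Δ (.T S) .baseRow
  | nil {Δ} : TyKind Δ .nil .row
  | nilBase {Δ} : TyKind Δ .nil .baseRow
  | cons {Δ} {l : Label} {A : Ty .con} {R : Ty .row} :
      TyKind Δ A .type → TyKind Δ R .row → TyKind Δ (.cons l A R) .row
  | consBase {Δ} {l : Label} {A : Ty .con} {R : Ty .row} :
      TyKind Δ A .baseType → TyKind Δ R .baseRow → TyKind Δ (.cons l A R) .baseRow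

/-- Well-formed contexts. -/
def CtxWF (Δ : List Kind) (Γ : List (Ty .con)) : Prop := ∀ A ∈ Γ, TyKind Δ A .type

/-! ### Computation and equivalence of constructors -/

/-- The reduction relation `C ⇝ C'`, `S ⇝ S'` on constructors and row constructors. -/
inductive Con.Red : {s : Srt} → Con s → Con s → Prop
  | consTail {l : Label} {C : Con .con} {S S' : Con .row} :
      Con.Red S S' → Con.Red (.cons l C S) (.cons l C S')
  | consHead {l : Label} {C C' : Con .con} {S : Con .row} :
      Con.Red C C' → Con.Red (.cons l C S) (.cons l C' S)
  | appFun {s : Srt} {C C' : Con .con} {D : Con s} :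
      Con.Red C C' → Con.Red (.app C D) (.app C' D)
  | appArg {s : Srt} {C : Con .con} {D D' : Con s} :
      Con.Red D D' → Con.Red (.app C D) (.app C D')
  | beta {s : Srt} {K : Kind} {C : Con .con} {D : Con s} :
      s = K.srt → Con.Red (.app (.lam K C) D) (C.inst D)
  | lam {K : Kind} {C C' : Con .con} : Con.Red C C' → Con.Red (.lam K C) (.lam K C')
  | list {C C' : Con .con} : Con.Red C C' → Con.Red (.list C) (.list C')
  | trace {C C' : Con .con} : Con.Red C C' → Con.Red (.trace C) (.trace C')
  | record {S S' : Con .row} : Con.Red S S' → Con.Red (.record S) (.record S')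
  | rmapNil {C : Con .con} : Con.Red (.rmap C .nil) .nil
  | rmapCons {l : Label} {C D : Con .con} {S : Con .row} :
      Con.Red (.rmap C (.cons l D S)) (.cons l (.app C D) (.rmap C S))
  | rmapRow {C : Con .con} {S S' : Con .row} :
      Con.Red S S' → Con.Red (.rmap C S) (.rmap C S')
  | rmapFun {C C' : Con .con} {S : Con .row} :
      Con.Red C C' → Con.Red (.rmap C S) (.rmap C' S)
  | trScrut {C C' CB CI CS CL CR CT : Con .con} : Con.Red C C' →
      Con.Red (.typerec C CB CI CS CL CR CT) (.typerec C' CB CI CS CL CR CT)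
  | trB {C CB CB' CI CS CL CR CT : Con .con} : Con.Red CB CB' →
      Con.Red (.typerec C CB CI CS CL CR CT) (.typerec C CB' CI CS CL CR CT)
  | trI {C CB CI CI' CS CL CR CT : Con .con} : Con.Red CI CI' →
      Con.Red (.typerec C CB CI CS CL CR CT) (.typerec C CB CI' CS CL CR CT)
  | trS {C CB CI CS CS' CL CR CT : Con .con} : Con.Red CS CS' →
      Con.Red (.typerec C CB CI CS CL CR CT) (.typerec C CB CI CS' CL CR CT)
  | trL {C CB CI CS CL CL' CR CT : Con .con} : Con.Red CL CL' →
      Con.Red (.typerec C CB CI CS CL CR CT) (.typerec C CB CI CS CL' CR CT)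
  | trR {C CB CI CS CL CR CR' CT : Con .con} : Con.Red CR CR' →
      Con.Red (.typerec C CB CI CS CL CR CT) (.typerec C CB CI CS CL CR' CT)
  | trT {C CB CI CS CL CR CT CT' : Con .con} : Con.Red CT CT' →
      Con.Red (.typerec C CB CI CS CL CR CT) (.typerec C CB CI CS CL CR CT')
  | trBool {CB CI CS CL CR CT : Con .con} : Con.Red (.typerec .bool CB CI CS CL CR CT) CB
  | trInt {CB CI CS CL CR CT : Con .con} : Con.Red (.typerec .int CB CI CS CL CR CT) CI
  | trStr {CB CI CS CL CR CT : Con .con} : Con.Red (.typerec .str CB CI CS CL CR CT) CS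
  | trList {D CB CI CS CL CR CT : Con .con} :
      Con.Red (.typerec (.list D) CB CI CS CL CR CT)
        (.app (.app CL D) (.typerec D CB CI CS CL CR CT))
  | trRecord {S : Con .row} {CB CI CS CL CR CT : Con .con} :
      Con.Red (.typerec (.record S) CB CI CS CL CR CT)
        (.app (.app CR S)
          (.rmap (.lam .type
            (.typerec (.var .con 0) CB.wk CI.wk CS.wk CL.wk CR.wk CT.wk)) S))
  | trTrace {D CB CI CS CL CR CT : Con .con} :
      Con.Red (.typerec (.trace D) CB CI CS CL CR CT)
        (.app (.app CT D) (.typerec D CB CI CS CL CR CT))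

/-- Equivalence `Δ ⊢ C = D : K` of constructors and of row constructors. -/
inductive ConEq : List Kind → {s : Srt} → Con s → Con s → Kind → Prop
  | refl {Δ} {s : Srt} {C : Con s} {K : Kind} : HasKind Δ C K → ConEq Δ C C K
  | symm {Δ} {s : Srt} {C D : Con s} {K : Kind} : ConEq Δ D C K → ConEq Δ C D K
  | trans {Δ} {s : Srt} {C C' C'' : Con s} {K : Kind} :
      ConEq Δ C C' K → ConEq Δ C' C'' K → ConEq Δ C C'' K
  | sub {Δ} {s : Srt} {C D : Con s} {K K' : Kind} :
      ConEq Δ C D K → Subkind K K' → ConEq Δ C D K'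
  | eta {Δ} {C : Con .con} {K K' : Kind} :
      HasKind Δ C (.arr K K') →
      ConEq Δ (.lam K (.app C.wk (.var K.srt 0))) C (.arr K K')
  | lam {Δ} {C D : Con .con} {K K' : Kind} :
      ConEq (K :: Δ) C D K' → ConEq Δ (.lam K C) (.lam K D) (.arr K K')
  | app {Δ} {s : Srt} {C C' : Con .con} {D D' : Con s} {K K' : Kind} :
      ConEq Δ C C' (.arr K' K) → s = K'.srt → ConEq Δ D D' K' →
      ConEq Δ (.app C D) (.app C' D') K
  | list {Δ} {C D : Con .con} : ConEq Δ C D .type → ConEq Δ (.list C) (.list D) .type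
  | record {Δ} {S S' : Con .row} :
      ConEq Δ S S' .row → ConEq Δ (.record S) (.record S') .type
  | trace {Δ} {C D : Con .con} : ConEq Δ C D .baseType → ConEq Δ (.trace C) (.trace D) .type
  | red {Δ} {s : Srt} {C D : Con s} {K : Kind} :
      HasKind Δ C K → HasKind Δ D K → Con.Red C D → ConEq Δ C D K
  | nil {Δ} : ConEq Δ .nil .nil .row
  | cons {Δ} {l : Label} {C D : Con .con} {S S' : Con .row} :
      ConEq Δ C D .type → ConEq Δ S S' .row → ConEq Δ (.cons l C S) (.cons l D S') .row
  | consBase {Δ} {l : Label} {C D : Con .con} {S S' : Con .row} :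
      ConEq Δ C D .baseType → ConEq Δ S S' .baseRow →
      ConEq Δ (.cons l C S) (.cons l D S') .baseRow
  | rmap {Δ} {C D : Con .con} {S S' : Con .row} :
      ConEq Δ C D (.arr .type .type) → ConEq Δ S S' .row →
      ConEq Δ (.rmap C S) (.rmap D S') .row
  | typerec {Δ} {K : Kind} {C C' CB CB' CI CI' CS CS' CL CL' CR CR' CT CT' : Con .con} :
      ConEq Δ C C' .type → ConEq Δ CB CB' K → ConEq Δ CI CI' K → ConEq Δ CS CS' K →
      ConEq Δ CL CL' (.arr .type (.arr K K)) →
      ConEq Δ CR CR' (.arr .row (.arr .row K)) →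
      ConEq Δ CT CT' (.arr .baseType (.arr K K)) →
      ConEq Δ (.typerec C CB CI CS CL CR CT) (.typerec C' CB' CI' CS' CL' CR' CT') K

/-- Equivalence `Δ ⊢ A = B : K` of types and of row types. -/
inductive TyEq : List Kind → {s : Srt} → Ty s → Ty s → Kind → Prop
  | refl {Δ} {s : Srt} {A : Ty s} {K : Kind} : TyKind Δ A K → TyEq Δ A A K
  | symm {Δ} {s : Srt} {A B : Ty s} {K : Kind} : TyEq Δ B A K → TyEq Δ A B K
  | trans {Δ} {s : Srt} {A B C : Ty s} {K : Kind} :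
      TyEq Δ A B K → TyEq Δ B C K → TyEq Δ A C K
  | sub {Δ} {s : Srt} {A B : Ty s} {K K' : Kind} :
      TyEq Δ A B K → Subkind K K' → TyEq Δ A B K'
  | TBool {Δ} : TyEq Δ (.T .bool) .bool .baseType
  | TInt {Δ} : TyEq Δ (.T .int) .int .baseType
  | TStr {Δ} : TyEq Δ (.T .str) .str .baseType
  | TList {Δ} {C : Con .con} :
      HasKind Δ C .type → TyEq Δ (.T (.list C)) (.list (.T C)) .type
  | TRecord {Δ} {S : Con .row} :
      HasKind Δ S .row → TyEq Δ (.T (.record S)) (.record (.T S)) .type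
  | TTrace {Δ} {C : Con .con} :
      HasKind Δ C .baseType → TyEq Δ (.T (.trace C)) (.trace (.T C)) .type
  | TNil {Δ} : TyEq Δ (.T .nil) .nil .row
  | TCons {Δ} {l : Label} {C : Con .con} {S : Con .row} :
      HasKind Δ C .type → HasKind Δ S .row →
      TyEq Δ (.T (.cons l C S)) (.cons l (.T C) (.T S)) .row
  | T {Δ} {C D : Con .con} : ConEq Δ C D .type → TyEq Δ (.T C) (.T D) .type
  | TBase {Δ} {C D : Con .con} : ConEq Δ C D .baseType → TyEq Δ (.T C) (.T D) .baseType
  | TRow {Δ} {S S' : Con .row} : ConEq Δ S S' .row → TyEq Δ (.T S) (.T S') .row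
  | TBaseRow {Δ} {S S' : Con .row} : ConEq Δ S S' .baseRow → TyEq Δ (.T S) (.T S') .baseRow
  | list {Δ} {A B : Ty .con} : TyEq Δ A B .type → TyEq Δ (.list A) (.list B) .type
  | record {Δ} {R R' : Ty .row} :
      TyEq Δ R R' .row → TyEq Δ (.record R) (.record R') .type
  | trace {Δ} {A B : Ty .con} : TyEq Δ A B .baseType → TyEq Δ (.trace A) (.trace B) .type
  | fn {Δ} {A A' B B' : Ty .con} :
      TyEq Δ A A' .type → TyEq Δ B B' .type → TyEq Δ (.fn A B) (.fn A' B') .type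
  | all {Δ} {K : Kind} {A B : Ty .con} :
      TyEq (K :: Δ) A B .type → TyEq Δ (.all K A) (.all K B) .type
  | nil {Δ} : TyEq Δ .nil .nil .row
  | cons {Δ} {l : Label} {A B : Ty .con} {R R' : Ty .row} :
      TyEq Δ A B .type → TyEq Δ R R' .row → TyEq Δ (.cons l A R) (.cons l B R') .row
  | consBase {Δ} {l : Label} {A B : Ty .con} {R R' : Ty .row} :
      TyEq Δ A B .baseType → TyEq Δ R R' .baseRow →
      TyEq Δ (.cons l A R) (.cons l B R') .baseRow

/-! ### Typing -/

/-- The signature of the constants. -/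
def Const.ty : Const → Ty .con
  | .bool _ => .bool
  | .int _ => .int
  | .str _ => .str

/-- The type-level function `TRACE`. -/
def TRACE : Con .con :=
  .lam .type (.typerec (.var .con 0) (.trace .bool) (.trace .int) (.trace .str)
    (.lam .type (.lam .type (.list (.var .con 0))))
    (.lam .row (.lam .row (.record (.var .row 0))))
    (.lam .baseType (.lam .type (.var .con 0))))

/-- `T(TRACE C)` -/
def Ty.TTRACE (C : Con .con) : Ty .con := .T (.app TRACE C)

/-- `⟨cond : Trace Bool, out : Trace A⟩` -/
def Ty.ifRec (A : Ty .con) : Ty .con :=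
  .record (.cons .cond (.trace .bool) (.cons .out (.trace A) .nil))

/-- `⟨in : T(TRACE C), out : Trace A⟩` -/
def Ty.forRec (C : Con .con) (A : Ty .con) : Ty .con :=
  .record (.cons .input (.TTRACE C) (.cons .out (.trace A) .nil))

/-- `⟨table : String, column : String, row : Int, data : A⟩` -/
def Ty.cellRec (A : Ty .con) : Ty .con :=
  .record (.cons .table .str (.cons .column .str (.cons .row .int (.cons .data A .nil))))

/-- `⟨left : A, right : A⟩` -/
def Ty.opRec (A : Ty .con) : Ty .con :=
  .record (.cons .left A (.cons .right A .nil))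

/-- A context of term variables, moved under a binder of a type or row variable. -/
abbrev wkCtx (Γ : List (Ty .con)) : List (Ty .con) := Γ.map Ty.wk

/-- Term formation `Δ; Γ ⊢ M : A`. -/
inductive HasType : List Kind → List (Ty .con) → Tm → Ty .con → Prop
  | const {Δ Γ} {c : Const} : HasType Δ Γ (.const c) c.ty
  | var {Δ} {Γ : List (Ty .con)} {n : ℕ} {A : Ty .con} :
      Γ[n]? = some A → HasType Δ Γ (.var n) A
  | lam {Δ Γ} {A B : Ty .con} {M : Tm} :
      TyKind Δ A .type → HasType Δ (A :: Γ) M B → HasType Δ Γ (.lam A M) (.fn A B)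
  | app {Δ Γ} {A B : Ty .con} {M N : Tm} :
      HasType Δ Γ M (.fn A B) → HasType Δ Γ N A → HasType Δ Γ (.app M N) B
  | tlam {Δ Γ} {K : Kind} {A : Ty .con} {M : Tm} :
      HasType (K :: Δ) (wkCtx Γ) M A → HasType Δ Γ (.tlam K M) (.all K A)
  | tapp {Δ Γ} {s : Srt} {K : Kind} {A : Ty .con} {M : Tm} {C : Con s} :
      HasType Δ Γ M (.all K A) → s = K.srt → HasKind Δ C K →
      HasType Δ Γ (.tapp M C) (A.inst C)
  | fix {Δ Γ} {A : Ty .con} {M : Tm} :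
      TyKind Δ A .type → HasType Δ (A :: Γ) M A → HasType Δ Γ (.fix A M) A
  | ite {Δ Γ} {A : Ty .con} {L M N : Tm} :
      HasType Δ Γ L .bool → HasType Δ Γ M A → HasType Δ Γ N A → HasType Δ Γ (.ite L M N) A
  | plus {Δ Γ} {M N : Tm} :
      HasType Δ Γ M .int → HasType Δ Γ N .int → HasType Δ Γ (.plus M N) .int
  | eq {Δ Γ} {A : Ty .con} {M N : Tm} :
      HasType Δ Γ M A → HasType Δ Γ N A → TyKind Δ A .baseType →
      HasType Δ Γ (.eq M N) .bool
  | table {Δ Γ} {n : String} {R : Ty .row} :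
      TyKind [] R .baseRow →
      HasType Δ Γ (.table n (.cons .oid .int R)) (.list (.record (.cons .oid .int R)))
  | nil {Δ Γ} {A : Ty .con} : TyKind Δ A .type → HasType Δ Γ .nil (.list A)
  | single {Δ Γ} {A : Ty .con} {M : Tm} :
      HasType Δ Γ M A → HasType Δ Γ (.single M) (.list A)
  | append {Δ Γ} {A : Ty .con} {M N : Tm} :
      HasType Δ Γ M (.list A) → HasType Δ Γ N (.list A) →
      HasType Δ Γ (.append M N) (.list A)
  | for {Δ Γ} {A B : Ty .con} {M N : Tm} :
      HasType Δ Γ M (.list A) → HasType Δ (A :: Γ) N (.list B) →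
      HasType Δ Γ (.for M N) (.list B)
  | unit {Δ Γ} : CtxWF Δ Γ → HasType Δ Γ .unit (.record .nil)
  | ext {Δ Γ} {l : Label} {A : Ty .con} {R : Ty .row} {M N : Tm} :
      HasType Δ Γ M A → HasType Δ Γ N (.record R) →
      HasType Δ Γ (.ext l M N) (.record (.cons l A R))
  | proj {Δ Γ} {l : Label} {A : Ty .con} {R : Ty .row} {M : Tm} :
      HasType Δ Γ M (.record (.cons l A R)) → HasType Δ Γ (.proj M l) A
  | conv {Δ Γ} {A B : Ty .con} {M : Tm} :
      HasType Δ Γ M B → TyEq Δ A B .type → HasType Δ Γ M A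
  | rmap {Δ Γ} {C : Con .con} {S : Con .row} {M N : Tm} :
      HasKind Δ S .row →
      HasType Δ Γ M (.all .type (.fn (.T (.var .con 0)) (.T (.app C.wk (.var .con 0))))) →
      HasType Δ Γ N (.T (.record S)) →
      HasType Δ Γ (.rmap S M N) (.T (.record (.rmap C S)))
  | rfold {Δ Γ} {C : Con .con} {S : Con .row} {L M N : Tm} :
      HasKind Δ S .row →
      HasType Δ Γ L (.fn (.T C) (.fn (.T C) (.T C))) →
      HasType Δ Γ M (.T C) →
      HasType Δ Γ N (.T (.record (.rmap (.lam .type C.wk) S))) →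
      HasType Δ Γ (.rfold S L M N) (.T C)
  | typecase {Δ Γ} {B : Ty .con} {C : Con .con} {MB MI MS ML MR MT : Tm} :
      HasKind Δ C .type →
      TyKind (.type :: Δ) B .type →
      HasType Δ Γ MB (B.inst Con.bool) →
      HasType Δ Γ MI (B.inst Con.int) →
      HasType Δ Γ MS (B.inst Con.str) →
      HasType (.type :: Δ) (wkCtx Γ) ML
        ((B.ren (liftRen Nat.succ)).inst (Con.list (.var .con 0))) →
      HasType (.row :: Δ) (wkCtx Γ) MR
        ((B.ren (liftRen Nat.succ)).inst (Con.record (.var .row 0))) →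
      HasType (.baseType :: Δ) (wkCtx Γ) MT
        ((B.ren (liftRen Nat.succ)).inst (Con.trace (.var .con 0))) →
      HasType Δ Γ (.typecase C MB MI MS ML MR MT) (B.inst C)
  | litBool {Δ Γ} {M : Tm} : HasType Δ Γ M .bool → HasType Δ Γ (.trLit M) (.trace .bool)
  | litInt {Δ Γ} {M : Tm} : HasType Δ Γ M .int → HasType Δ Γ (.trLit M) (.trace .int)
  | litStr {Δ Γ} {M : Tm} : HasType Δ Γ M .str → HasType Δ Γ (.trLit M) (.trace .str)
  | trIf {Δ Γ} {A : Ty .con} {M : Tm} :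
      HasType Δ Γ M (.ifRec A) → HasType Δ Γ (.trIf M) (.trace A)
  | trFor {Δ Γ} {A : Ty .con} {C : Con .con} {M : Tm} :
      HasKind Δ C .type → HasType Δ Γ M (.forRec C A) → HasType Δ Γ (.trFor C M) (.trace A)
  | trCell {Δ Γ} {A : Ty .con} {M : Tm} :
      HasType Δ Γ M (.cellRec A) → HasType Δ Γ (.trCell M) (.trace A)
  | trOpEq {Δ Γ} {C : Con .con} {M : Tm} :
      HasKind Δ C .baseType → HasType Δ Γ M (.opRec (.TTRACE C)) →
      HasType Δ Γ (.trOpEq C M) (.trace .bool)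
  | trOpPlus {Δ Γ} {M : Tm} :
      HasType Δ Γ M (.opRec (.trace .int)) → HasType Δ Γ (.trOpPlus M) (.trace .int)
  | tracecase {Δ Γ} {A B : Ty .con} {M ML MI MF MC ME MP : Tm} :
      HasType Δ Γ M (.trace A) →
      HasType Δ (A :: Γ) ML B →
      HasType Δ (.ifRec A :: Γ) MI B →
      HasType (.type :: Δ) (.forRec (.var .con 0) A.wk :: wkCtx Γ) MF B.wk →
      HasType Δ (.cellRec A :: Γ) MC B →
      HasType (.baseType :: Δ) (.opRec (.TTRACE (.var .con 0)) :: wkCtx Γ) ME B.wk →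
      HasType Δ (.opRec (.trace .int) :: Γ) MP B →
      HasType Δ Γ (.tracecase M ML MI MF MC ME MP) B

/-! ### Reduction of terms -/

/-- `Maps N l M`: the record expression `N` is a literal `⟨l₁ = M₁; …; lₙ = Mₙ; N'⟩` in which
`M` is the component of the first occurrence of `l` among the `lᵢ`. -/
inductive Maps : Tm → Label → Tm → Prop
  | here {l : Label} {M N : Tm} : Maps (.ext l M N) l M
  | there {k l : Label} {M M' N : Tm} : k ≠ l → Maps N l M' → Maps (.ext k M N) l M'

/-- The closed row `l₁ : C₁; …; lₙ : Cₙ; ·`. -/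
def rowOf : List (Label × Con .con) → Con .row
  | [] => .nil
  | (l, C) :: fs => .cons l C (rowOf fs)

/-- `⟨l₁ = (M C₁) N.l₁; …; lₙ = (M Cₙ) N.lₙ⟩` -/
def rmapOf (M N : Tm) : List (Label × Con .con) → Tm
  | [] => .unit
  | (l, C) :: fs => .ext l (.app (.tapp M C) (.proj N l)) (rmapOf M N fs)

/-- `L N.l₁ (L N.l₂ … (L N.lₙ M) …)` -/
def rfoldOf (L M N : Tm) : List (Label × Con .con) → Tm
  | [] => M
  | (l, _) :: fs => .app (.app L (.proj N l)) (rfoldOf L M N fs)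

/-- The reduction relation `M ⇝ M'` on terms: β-rules, commuting conversions, congruence rules. -/
inductive Tm.Red : Tm → Tm → Prop
  -- β-rules
  | beta {A : Ty .con} {M N : Tm} : Tm.Red (.app (.lam A M) N) (M.inst N)
  | fix {A : Ty .con} {M : Tm} : Tm.Red (.fix A M) (M.inst (.fix A M))
  | tbeta {s : Srt} {K : Kind} {M : Tm} {C : Con s} :
      s = K.srt → Tm.Red (.tapp (.tlam K M) C) (M.tinst C)
  | iteTrue {M N : Tm} : Tm.Red (.ite (.const (.bool true)) M N) M
  | iteFalse {M N : Tm} : Tm.Red (.ite (.const (.bool false)) M N) N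
  | projExt {l : Label} {M N : Tm} : Maps N l M → Tm.Red (.proj N l) M
  | rmapClosed {fs : List (Label × Con .con)} {M N : Tm} :
      Tm.Red (.rmap (rowOf fs) M N) (rmapOf M N fs)
  | rfoldClosed {fs : List (Label × Con .con)} {L M N : Tm} :
      Tm.Red (.rfold (rowOf fs) L M N) (rfoldOf L M N fs)
  | forNil {N : Tm} : Tm.Red (.for .nil N) .nil
  | forSingle {M N : Tm} : Tm.Red (.for (.single M) N) (N.inst M)
  | tcLit {M ML MI MF MC ME MP : Tm} :
      Tm.Red (.tracecase (.trLit M) ML MI MF MC ME MP) (ML.inst M)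
  | tcIf {M ML MI MF MC ME MP : Tm} :
      Tm.Red (.tracecase (.trIf M) ML MI MF MC ME MP) (MI.inst M)
  | tcFor {C : Con .con} {M ML MI MF MC ME MP : Tm} :
      Tm.Red (.tracecase (.trFor C M) ML MI MF MC ME MP) ((MF.tinst C).inst M)
  | tcCell {M ML MI MF MC ME MP : Tm} :
      Tm.Red (.tracecase (.trCell M) ML MI MF MC ME MP) (MC.inst M)
  | tcOpEq {C : Con .con} {M ML MI MF MC ME MP : Tm} :
      Tm.Red (.tracecase (.trOpEq C M) ML MI MF MC ME MP) ((ME.tinst C).inst M)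
  | tcOpPlus {M ML MI MF MC ME MP : Tm} :
      Tm.Red (.tracecase (.trOpPlus M) ML MI MF MC ME MP) (MP.inst M)
  | tyBool {MB MI MS ML MR MT : Tm} : Tm.Red (.typecase .bool MB MI MS ML MR MT) MB
  | tyInt {MB MI MS ML MR MT : Tm} : Tm.Red (.typecase .int MB MI MS ML MR MT) MI
  | tyStr {MB MI MS ML MR MT : Tm} : Tm.Red (.typecase .str MB MI MS ML MR MT) MS
  | tyList {C : Con .con} {MB MI MS ML MR MT : Tm} :
      Tm.Red (.typecase (.list C) MB MI MS ML MR MT) (ML.tinst C)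
  | tyRecord {S : Con .row} {MB MI MS ML MR MT : Tm} :
      Tm.Red (.typecase (.record S) MB MI MS ML MR MT) (MR.tinst S)
  | tyTrace {C : Con .con} {MB MI MS ML MR MT : Tm} :
      Tm.Red (.typecase (.trace C) MB MI MS ML MR MT) (MT.tinst C)
  -- commuting conversions
  | ccApp {L M₁ M₂ N : Tm} :
      Tm.Red (.app (.ite L M₁ M₂) N) (.ite L (.app M₁ N) (.app M₂ N))
  | ccTapp {s : Srt} {L M₁ M₂ : Tm} {C : Con s} :
      Tm.Red (.tapp (.ite L M₁ M₂) C) (.ite L (.tapp M₁ C) (.tapp M₂ C))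
  | ccProj {l : Label} {L M N : Tm} :
      Tm.Red (.proj (.ite L M N) l) (.ite L (.proj M l) (.proj N l))
  | ccForAppend {M₁ M₂ N : Tm} :
      Tm.Red (.for (.append M₁ M₂) N) (.append (.for M₁ N) (.for M₂ N))
  | ccForFor {L M N : Tm} :
      Tm.Red (.for (.for L M) N) (.for L (.for M (N.ren (liftRen Nat.succ))))
  | ccIte {L M₁ M₂ N₁ N₂ : Tm} :
      Tm.Red (.ite (.ite L M₁ M₂) N₁ N₂) (.ite L (.ite M₁ N₁ N₂) (.ite M₂ N₁ N₂))
  | ccForIte {L M₁ M₂ N : Tm} :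
      Tm.Red (.for (.ite L M₁ M₂) N) (.ite L (.for M₁ N) (.for M₂ N))
  | ccTracecase {L M₁ M₂ ML MI MF MC ME MP : Tm} :
      Tm.Red (.tracecase (.ite L M₁ M₂) ML MI MF MC ME MP)
        (.ite L (.tracecase M₁ ML MI MF MC ME MP) (.tracecase M₂ ML MI MF MC ME MP))
  -- congruence rules
  | lam {A : Ty .con} {M M' : Tm} : Tm.Red M M' → Tm.Red (.lam A M) (.lam A M')
  | app₁ {M M' N : Tm} : Tm.Red M M' → Tm.Red (.app M N) (.app M' N)
  | app₂ {M N N' : Tm} : Tm.Red N N' → Tm.Red (.app M N) (.app M N')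
  | tlam {K : Kind} {M M' : Tm} : Tm.Red M M' → Tm.Red (.tlam K M) (.tlam K M')
  | tapp₁ {s : Srt} {M M' : Tm} {C : Con s} :
      Tm.Red M M' → Tm.Red (.tapp M C) (.tapp M' C)
  | tapp₂ {s : Srt} {M : Tm} {C C' : Con s} :
      Con.Red C C' → Tm.Red (.tapp M C) (.tapp M C')
  | ite₁ {L L' M N : Tm} : Tm.Red L L' → Tm.Red (.ite L M N) (.ite L' M N)
  | ite₂ {L M M' N : Tm} : Tm.Red M M' → Tm.Red (.ite L M N) (.ite L M' N)
  | ite₃ {L M N N' : Tm} : Tm.Red N N' → Tm.Red (.ite L M N) (.ite L M N')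
  | ext₁ {l : Label} {M M' N : Tm} : Tm.Red M M' → Tm.Red (.ext l M N) (.ext l M' N)
  | ext₂ {l : Label} {M N N' : Tm} : Tm.Red N N' → Tm.Red (.ext l M N) (.ext l M N')
  | proj {l : Label} {M M' : Tm} : Tm.Red M M' → Tm.Red (.proj M l) (.proj M' l)
  | rmap₁ {S S' : Con .row} {M N : Tm} :
      Con.Red S S' → Tm.Red (.rmap S M N) (.rmap S' M N)
  | rmap₂ {S : Con .row} {M M' N : Tm} : Tm.Red M M' → Tm.Red (.rmap S M N) (.rmap S M' N)
  | rmap₃ {S : Con .row} {M N N' : Tm} : Tm.Red N N' → Tm.Red (.rmap S M N) (.rmap S M N')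
  | rfold₁ {S S' : Con .row} {L M N : Tm} :
      Con.Red S S' → Tm.Red (.rfold S L M N) (.rfold S' L M N)
  | rfold₂ {S : Con .row} {L L' M N : Tm} :
      Tm.Red L L' → Tm.Red (.rfold S L M N) (.rfold S L' M N)
  | rfold₃ {S : Con .row} {L M M' N : Tm} :
      Tm.Red M M' → Tm.Red (.rfold S L M N) (.rfold S L M' N)
  | rfold₄ {S : Con .row} {L M N N' : Tm} :
      Tm.Red N N' → Tm.Red (.rfold S L M N) (.rfold S L M N')
  | single {M M' : Tm} : Tm.Red M M' → Tm.Red (.single M) (.single M')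
  | append₁ {M M' N : Tm} : Tm.Red M M' → Tm.Red (.append M N) (.append M' N)
  | append₂ {M N N' : Tm} : Tm.Red N N' → Tm.Red (.append M N) (.append M N')
  | eq₁ {M M' N : Tm} : Tm.Red M M' → Tm.Red (.eq M N) (.eq M' N)
  | eq₂ {M N N' : Tm} : Tm.Red N N' → Tm.Red (.eq M N) (.eq M N')
  | plus₁ {M M' N : Tm} : Tm.Red M M' → Tm.Red (.plus M N) (.plus M' N)
  | plus₂ {M N N' : Tm} : Tm.Red N N' → Tm.Red (.plus M N) (.plus M N')
  | for₁ {M M' N : Tm} : Tm.Red M M' → Tm.Red (.for M N) (.for M' N)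
  | for₂ {M N N' : Tm} : Tm.Red N N' → Tm.Red (.for M N) (.for M N')
  | trLit {M M' : Tm} : Tm.Red M M' → Tm.Red (.trLit M) (.trLit M')
  | trIf {M M' : Tm} : Tm.Red M M' → Tm.Red (.trIf M) (.trIf M')
  | trFor₁ {C C' : Con .con} {M : Tm} : Con.Red C C' → Tm.Red (.trFor C M) (.trFor C' M)
  | trFor₂ {C : Con .con} {M M' : Tm} : Tm.Red M M' → Tm.Red (.trFor C M) (.trFor C M')
  | trCell {M M' : Tm} : Tm.Red M M' → Tm.Red (.trCell M) (.trCell M')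
  | trOpEq₁ {C C' : Con .con} {M : Tm} : Con.Red C C' → Tm.Red (.trOpEq C M) (.trOpEq C' M)
  | trOpEq₂ {C : Con .con} {M M' : Tm} : Tm.Red M M' → Tm.Red (.trOpEq C M) (.trOpEq C M')
  | trOpPlus {M M' : Tm} : Tm.Red M M' → Tm.Red (.trOpPlus M) (.trOpPlus M')
  | tcScrut {M M' ML MI MF MC ME MP : Tm} : Tm.Red M M' →
      Tm.Red (.tracecase M ML MI MF MC ME MP) (.tracecase M' ML MI MF MC ME MP)
  | tcL {M ML ML' MI MF MC ME MP : Tm} : Tm.Red ML ML' →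
      Tm.Red (.tracecase M ML MI MF MC ME MP) (.tracecase M ML' MI MF MC ME MP)
  | tcI {M ML MI MI' MF MC ME MP : Tm} : Tm.Red MI MI' →
      Tm.Red (.tracecase M ML MI MF MC ME MP) (.tracecase M ML MI' MF MC ME MP)
  | tcF {M ML MI MF MF' MC ME MP : Tm} : Tm.Red MF MF' →
      Tm.Red (.tracecase M ML MI MF MC ME MP) (.tracecase M ML MI MF' MC ME MP)
  | tcC {M ML MI MF MC MC' ME MP : Tm} : Tm.Red MC MC' →
      Tm.Red (.tracecase M ML MI MF MC ME MP) (.tracecase M ML MI MF MC' ME MP)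
  | tcE {M ML MI MF MC ME ME' MP : Tm} : Tm.Red ME ME' →
      Tm.Red (.tracecase M ML MI MF MC ME MP) (.tracecase M ML MI MF MC ME' MP)
  | tcP {M ML MI MF MC ME MP MP' : Tm} : Tm.Red MP MP' →
      Tm.Red (.tracecase M ML MI MF MC ME MP) (.tracecase M ML MI MF MC ME MP')
  | tyScrut {C C' : Con .con} {MB MI MS ML MR MT : Tm} : Con.Red C C' →
      Tm.Red (.typecase C MB MI MS ML MR MT) (.typecase C' MB MI MS ML MR MT)
  | tyB {C : Con .con} {MB MB' MI MS ML MR MT : Tm} : Tm.Red MB MB' →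
      Tm.Red (.typecase C MB MI MS ML MR MT) (.typecase C MB' MI MS ML MR MT)
  | tyI {C : Con .con} {MB MI MI' MS ML MR MT : Tm} : Tm.Red MI MI' →
      Tm.Red (.typecase C MB MI MS ML MR MT) (.typecase C MB MI' MS ML MR MT)
  | tyS {C : Con .con} {MB MI MS MS' ML MR MT : Tm} : Tm.Red MS MS' →
      Tm.Red (.typecase C MB MI MS ML MR MT) (.typecase C MB MI MS' ML MR MT)
  | tyL {C : Con .con} {MB MI MS ML ML' MR MT : Tm} : Tm.Red ML ML' →
      Tm.Red (.typecase C MB MI MS ML MR MT) (.typecase C MB MI MS ML' MR MT)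
  | tyR {C : Con .con} {MB MI MS ML MR MR' MT : Tm} : Tm.Red MR MR' →
      Tm.Red (.typecase C MB MI MS ML MR MT) (.typecase C MB MI MS ML MR' MT)
  | tyT {C : Con .con} {MB MI MS ML MR MT MT' : Tm} : Tm.Red MT MT' →
      Tm.Red (.typecase C MB MI MS ML MR MT) (.typecase C MB MI MS ML MR MT')

/-! ### Normal forms -/

mutual

/-- Normal constructors `C`. -/
inductive NormalC : Con .con → Prop
  | neutral {E : Con .con} : NeutralC E → NormalC E
  | bool : NormalC .bool
  | int : NormalC .int
  | str : NormalC .str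
  | lam {K : Kind} {C : Con .con} : NormalC C → NormalC (.lam K C)
  | list {C : Con .con} : NormalC C → NormalC (.list C)
  | record {S : Con .row} : NormalR S → NormalC (.record S)
  | trace {C : Con .con} : NormalC C → NormalC (.trace C)

/-- Neutral constructors `E`. -/
inductive NeutralC : Con .con → Prop
  | var {n : ℕ} : NeutralC (.var .con n)
  | appC {E C : Con .con} : NeutralC E → NormalC C → NeutralC (.app E C)
  | appR {E : Con .con} {S : Con .row} : NeutralC E → NormalR S → NeutralC (.app E S)
  | typerec {E CB CI CS CL CR CT : Con .con} :
      NeutralC E → NormalC CB → NormalC CI → NormalC CS → NormalC CL → NormalC CR →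
      NormalC CT → NeutralC (.typerec E CB CI CS CL CR CT)

/-- Normal row constructors `S`. -/
inductive NormalR : Con .row → Prop
  | nil : NormalR .nil
  | cons {l : Label} {C : Con .con} {S : Con .row} :
      NormalC C → NormalR S → NormalR (.cons l C S)
  | neutral {U : Con .row} : NeutralR U → NormalR U

/-- Neutral row constructors `U`. -/
inductive NeutralR : Con .row → Prop
  | var {n : ℕ} : NeutralR (.var .row n)
  | cons {l : Label} {C : Con .con} {U : Con .row} :
      NormalC C → NeutralR U → NeutralR (.cons l C U)
  | rmap {C : Con .con} {U : Con .row} : NormalC C → NeutralR U → NeutralR (.rmap C U)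

end

mutual

/-- Normal terms `M`, `N`. -/
inductive Normal : Tm → Prop
  | neutral {F : Tm} : Neutral F → Normal F
  | const {c : Const} : Normal (.const c)
  | lam {A : Ty .con} {M : Tm} : Normal M → Normal (.lam A M)
  | tlam {K : Kind} {M : Tm} : Normal M → Normal (.tlam K M)
  | ite {H M N : Tm} : NeutralCond H → Normal M → Normal N → Normal (.ite H M N)
  | plus {M N : Tm} : Normal M → Normal N → Normal (.plus M N)
  | eq {M N : Tm} : Normal M → Normal N → Normal (.eq M N)
  | unit : Normal .unit
  | ext {l : Label} {M N : Tm} : Normal M → Normal N → Normal (.ext l M N)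
  | rmap {U : Con .row} {M N : Tm} :
      NeutralR U → Normal M → Normal N → Normal (.rmap U M N)
  | nil : Normal .nil
  | single {M : Tm} : Normal M → Normal (.single M)
  | append {M N : Tm} : Normal M → Normal N → Normal (.append M N)
  | for {T N : Tm} : NeutralTable T → Normal N → Normal (.for T N)
  | table {n : String} {R : Ty .row} : Normal (.table n R)
  | trLit {M : Tm} : Normal M → Normal (.trLit M)
  | trIf {M : Tm} : Normal M → Normal (.trIf M)
  | trFor {C : Con .con} {M : Tm} : NormalC C → Normal M → Normal (.trFor C M)
  | trCell {M : Tm} : Normal M → Normal (.trCell M)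
  | trOpEq {C : Con .con} {M : Tm} : NormalC C → Normal M → Normal (.trOpEq C M)
  | trOpPlus {M : Tm} : Normal M → Normal (.trOpPlus M)

/-- Neutral terms `F`. -/
inductive Neutral : Tm → Prop
  | var {n : ℕ} : Neutral (.var n)
  | proj {P : Tm} {l : Label} : NeutralProj P → Neutral (.proj P l)
  | app {F M : Tm} : Neutral F → Normal M → Neutral (.app F M)
  | tappC {F : Tm} {C : Con .con} : Neutral F → NormalC C → Neutral (.tapp F C)
  | tappR {F : Tm} {S : Con .row} : Neutral F → NormalR S → Neutral (.tapp F S)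
  | rfold {U : Con .row} {L M N : Tm} :
      NeutralR U → Normal L → Normal M → Normal N → Neutral (.rfold U L M N)
  | tracecase {F ML MI MF MC ME MP : Tm} :
      Neutral F → Normal ML → Normal MI → Normal MF → Normal MC → Normal ME → Normal MP →
      Neutral (.tracecase F ML MI MF MC ME MP)
  | typecase {E : Con .con} {MB MI MS ML MR MT : Tm} :
      NeutralC E → Normal MB → Normal MI → Normal MS → Normal ML → Normal MR → Normal MT →
      Neutral (.typecase E MB MI MS ML MR MT)

/-- Neutral conditionals `H`. -/
inductive NeutralCond : Tm → Prop
  | neutral {F : Tm} : Neutral F → NeutralCond F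
  | eq {M N : Tm} : Normal M → Normal N → NeutralCond (.eq M N)

/-- Neutral projections `P`. -/
inductive NeutralProj : Tm → Prop
  | neutral {F : Tm} : Neutral F → NeutralProj F
  | rmap {U : Con .row} {M N : Tm} :
      NeutralR U → Normal M → Normal N → NeutralProj (.rmap U M N)

/-- Neutral tables `T`. -/
inductive NeutralTable : Tm → Prop
  | neutral {F : Tm} : Neutral F → NeutralTable F
  | table {n : String} {R : Ty .row} : NeutralTable (.table n R)

end

end LinksT

/-! Kinds are interpreted as sets: `Type` as the set of closed type codes, `Row` as the set of
closed rows of codes, `K₁ → K₂` as the full function space.  Every well-kinded constructor has a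
value in this model, and constructor reduction preserves it.  Equivalent types therefore have the
same outermost type former, so that the normal terms of a given type have the expected canonical
forms, and every elimination form applied to one of them reduces or is neutral. -/

namespace LinksT

/-! ### Values of constructors -/

/-- Kinds with `BaseType` identified with `Type` and `BaseRow` with `Row`; they suffice to
interpret constructors because subkinding becomes equality. -/
inductive SKind : Type
  | ty | row
  | arr (k₁ k₂ : SKind)

/-- The simple kind underlying a kind. -/
def Kind.erase : Kind → SKind
  | .type => .ty
  | .baseType => .ty
  | .row => .row
  | .baseRow => .row
  | .arr K₁ K₂ => .arr K₁.erase K₂.erase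

/-- The sort of the variables of a simple kind, as `Kind.srt`. -/
def SKind.srt : SKind → Srt
  | .row => .row
  | _ => .con

theorem Kind.srt_erase (K : Kind) : K.erase.srt = K.srt := by cases K <;> rfl

theorem Kind.eq_srt_erase {s : Srt} {K : Kind} (h : s = K.srt) : s = K.erase.srt :=
  h.trans K.srt_erase.symm

theorem Subkind.erase_eq {K K' : Kind} (h : Subkind K K') : K.erase = K'.erase := by
  induction h with
  | refl | baseType | baseRow => rfl
  | arr _ _ ih₁ ih₂ => simp only [Kind.erase, ih₁, ih₂]

mutual

/-- Closed type codes, the values of kind `Type`. -/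
inductive Val : Type
  | bool | int | str
  | list (v : Val)
  | record (r : RowVal)
  | trace (v : Val)

/-- Rows of closed type codes, the values of kind `Row`. -/
inductive RowVal : Type
  | nil
  | cons (l : Label) (v : Val) (r : RowVal)

end

/-- The set interpreting a simple kind. -/
def SKind.El : SKind → Type
  | .ty => Val
  | .row => RowVal
  | .arr k₁ k₂ => k₁.El → k₂.El

/-- An arbitrary element of each kind; it shows that function spaces have inhabited domains. -/
def SKind.default : (k : SKind) → k.El
  | .ty => Val.bool
  | .row => RowVal.nil
  | .arr _ k₂ => fun _ => k₂.default

/-- Reads an element of any kind as a type code, with the junk value `bool` if it is not one. -/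
def SKind.toVal : (k : SKind) → k.El → Val
  | .ty, v => v
  | _, _ => .bool

/-- The values of the branches of a `Typerec` with result kind `k`. -/
structure Branches (k : SKind) where
  bool : k.El
  int : k.El
  str : k.El
  list : Val → k.El → k.El
  record : RowVal → RowVal → k.El
  trace : Val → k.El → k.El

/-- The interpretation of `Rmap`. -/
def RowVal.map (f : Val → Val) : RowVal → RowVal
  | .nil => .nil
  | .cons l v r => .cons l (f v) (r.map f)

mutual

/-- The interpretation of `Typerec`. -/
def Val.typerec {k : SKind} (B : Branches k) : Val → k.El
  | .bool => B.bool
  | .int => B.int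
  | .str => B.str
  | .list v => B.list v (v.typerec B)
  | .record r => B.record r (r.typerec B)
  | .trace v => B.trace v (v.typerec B)

/-- The interpretation of `Typerec` mapped over a row.  It is meaningful only if the result kind
is `Type`, since otherwise the recursive results do not form a row. -/
def RowVal.typerec {k : SKind} (B : Branches k) : RowVal → RowVal
  | .nil => .nil
  | .cons l v r => .cons l (k.toVal (v.typerec B)) (r.typerec B)

end

theorem RowVal.map_typerec (B : Branches .ty) :
    (r : RowVal) → r.map (Val.typerec B) = r.typerec B
  | .nil => rfl
  | .cons l v r => congrArg (RowVal.cons l (v.typerec B)) (r.map_typerec B)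

/-- Environments: simple kinds and values for the type and row variables. -/
abbrev Env : Type := List (Sigma SKind.El)

/-- `Den ρ C k v`: in the environment `ρ`, the constructor `C` has kind `k` and value `v`.  This is
a relation because constructors that are not well kinded have no value. -/
inductive Den : Env → {s : Srt} → Con s → (k : SKind) → k.El → Prop
  | var {ρ : Env} {s : Srt} {n : ℕ} {k : SKind} {v : k.El} :
      ρ[n]? = some ⟨k, v⟩ → s = k.srt → Den ρ (.var s n) k v
  | bool {ρ} : Den ρ .bool .ty Val.bool
  | int {ρ} : Den ρ .int .ty Val.int
  | str {ρ} : Den ρ .str .ty Val.str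
  | lam {ρ : Env} {K : Kind} {C : Con .con} {k : SKind} {f : K.erase.El → k.El} :
      (∀ v, Den (⟨K.erase, v⟩ :: ρ) C k (f v)) → Den ρ (.lam K C) (.arr K.erase k) f
  | app {ρ} {s : Srt} {C : Con .con} {D : Con s} {k₁ k₂ : SKind} {f : k₁.El → k₂.El}
      {v : k₁.El} :
      Den ρ C (.arr k₁ k₂) f → s = k₁.srt → Den ρ D k₁ v → Den ρ (.app C D) k₂ (f v)
  | list {ρ} {C : Con .con} {v : Val} : Den ρ C .ty v → Den ρ (.list C) .ty (Val.list v)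
  | record {ρ} {S : Con .row} {r : RowVal} :
      Den ρ S .row r → Den ρ (.record S) .ty (Val.record r)
  | trace {ρ} {C : Con .con} {v : Val} : Den ρ C .ty v → Den ρ (.trace C) .ty (Val.trace v)
  | typerec {ρ} {k : SKind} {C CB CI CS CL CR CT : Con .con} {v : Val} {b i s : k.El}
      {fl : Val → k.El → k.El} {fr : RowVal → RowVal → k.El} {ft : Val → k.El → k.El} :
      Den ρ C .ty v → Den ρ CB k b → Den ρ CI k i → Den ρ CS k s →
      Den ρ CL (.arr .ty (.arr k k)) fl → Den ρ CR (.arr .row (.arr .row k)) fr →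
      Den ρ CT (.arr .ty (.arr k k)) ft →
      Den ρ (.typerec C CB CI CS CL CR CT) k (v.typerec ⟨b, i, s, fl, fr, ft⟩)
  | nil {ρ} : Den ρ .nil .row RowVal.nil
  | cons {ρ} {l : Label} {C : Con .con} {S : Con .row} {v : Val} {r : RowVal} :
      Den ρ C .ty v → Den ρ S .row r → Den ρ (.cons l C S) .row (RowVal.cons l v r)
  | rmap {ρ} {C : Con .con} {S : Con .row} {f : Val → Val} {r : RowVal} :
      Den ρ C (.arr .ty .ty) f → Den ρ S .row r → Den ρ (.rmap C S) .row (RowVal.map f r)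

section Substitution

variable {ρ : Env} {s : Srt} {C : Con s} {k : SKind} {v : k.El}

theorem Den.ren (h : Den ρ C k v) {ρ' : Env} {ξ : ℕ → ℕ}
    (hξ : ∀ n x, ρ[n]? = some x → ρ'[ξ n]? = some x) : Den ρ' (C.ren ξ) k v := by
  induction h generalizing ρ' ξ with
  | var e hs => exact .var (hξ _ _ e) hs
  | bool => exact .bool
  | int => exact .int
  | str => exact .str
  | nil => exact .nil
  | lam _ ih =>
    refine .lam fun v => ih v fun n x e => ?_
    cases n with
    | zero => exact e
    | succ n => exact hξ n x e
  | app _ hs _ ihC ihD => exact .app (ihC hξ) hs (ihD hξ)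
  | list _ ih => exact .list (ih hξ)
  | record _ ih => exact .record (ih hξ)
  | trace _ ih => exact .trace (ih hξ)
  | typerec _ _ _ _ _ _ _ ihC ihB ihI ihS ihL ihR ihT =>
    exact .typerec (ihC hξ) (ihB hξ) (ihI hξ) (ihS hξ) (ihL hξ) (ihR hξ) (ihT hξ)
  | cons _ _ ihC ihS => exact .cons (ihC hξ) (ihS hξ)
  | rmap _ _ ihC ihS => exact .rmap (ihC hξ) (ihS hξ)

theorem Den.wk (h : Den ρ C k v) (x : Sigma SKind.El) : Den (x :: ρ) C.wk k v :=
  h.ren fun _ _ e => e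

theorem Den.subst (h : Den ρ C k v) {ρ' : Env} {σ : TSub}
    (hσ : ∀ n (x : Sigma SKind.El), ρ[n]? = some x → Den ρ' (σ x.1.srt n) x.1 x.2) :
    Den ρ' (C.subst σ) k v := by
  induction h generalizing ρ' σ with
  | var e hs => subst hs; exact hσ _ _ e
  | bool => exact .bool
  | int => exact .int
  | str => exact .str
  | nil => exact .nil
  | lam _ ih =>
    refine .lam fun v => ih v fun n x e => ?_
    cases n with
    | zero => cases e; exact .var rfl rfl
    | succ n => exact (hσ n x e).wk _
  | app _ hs _ ihC ihD => exact .app (ihC hσ) hs (ihD hσ)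
  | list _ ih => exact .list (ih hσ)
  | record _ ih => exact .record (ih hσ)
  | trace _ ih => exact .trace (ih hσ)
  | typerec _ _ _ _ _ _ _ ihC ihB ihI ihS ihL ihR ihT =>
    exact .typerec (ihC hσ) (ihB hσ) (ihI hσ) (ihS hσ) (ihL hσ) (ihR hσ) (ihT hσ)
  | cons _ _ ihC ihS => exact .cons (ihC hσ) (ihS hσ)
  | rmap _ _ ihC ihS => exact .rmap (ihC hσ) (ihS hσ)

theorem Den.inst {s' : Srt} {D : Con s'} {k' : SKind} {w : k'.El}
    (h : Den (⟨k', w⟩ :: ρ) C k v) (hs : s' = k'.srt) (hD : Den ρ D k' w) :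
    Den ρ (C.inst D) k v := by
  refine h.subst fun n x e => ?_
  cases n with
  | zero => cases e; subst hs; simpa only [TSub.inst, dite_true] using hD
  | succ n => exact .var e rfl

end Substitution

/-! ### Reduction and values -/

/-- No value of `C` differs from a value of `D`; either may fail to have one.  Reduction satisfies
only this weak form of invariance, since a reduct of an ill-kinded constructor may have a value
and a `Typerec` on a record may reduce to a constructor without one. -/
def Agree (ρ : Env) {s : Srt} (C D : Con s) : Prop :=
  ∀ ⦃k : SKind⦄ ⦃v : k.El⦄ ⦃k' : SKind⦄ ⦃v' : k'.El⦄,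
    Den ρ C k v → Den ρ D k' v' → (⟨k, v⟩ : Sigma SKind.El) = ⟨k', v'⟩

namespace Agree

variable {ρ : Env} {s : Srt} {C C' : Con .con} {S S' : Con .row}

theorem lam {K : Kind} (hC : ∀ v, Agree (⟨K.erase, v⟩ :: ρ) C C') :
    Agree ρ (.lam K C) (.lam K C') := by
  intro _ _ _ _ h h'
  cases h with
  | @lam _ _ _ k f d =>
    cases h' with
    | @lam _ _ _ k' f' d' =>
      have hval := fun v => hC v (d v) (d' v)
      obtain rfl : k = k' := congrArg Sigma.fst (hval K.erase.default)
      obtain rfl : f = f' := funext fun v => eq_of_heq (Sigma.mk.inj (hval v)).2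
      rfl

theorem app {D D' : Con s} (hC : Agree ρ C C') (hD : Agree ρ D D') :
    Agree ρ (.app C D) (.app C' D') := by
  intro _ _ _ _ h h'
  cases h with
  | app dC _ dD => cases h' with
    | app dC' _ dD' => cases hD dD dD'; cases hC dC dC'; rfl

theorem list (hC : Agree ρ C C') : Agree ρ (.list C) (.list C') := by
  intro _ _ _ _ h h'
  cases h with
  | list d => cases h' with
    | list d' => cases hC d d'; rfl

theorem record (hS : Agree ρ S S') : Agree ρ (.record S) (.record S') := by
  intro _ _ _ _ h h'
  cases h with
  | record d => cases h' with
    | record d' => cases hS d d'; rfl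

theorem trace (hC : Agree ρ C C') : Agree ρ (.trace C) (.trace C') := by
  intro _ _ _ _ h h'
  cases h with
  | trace d => cases h' with
    | trace d' => cases hC d d'; rfl

theorem typerec {CB CB' CI CI' CS CS' CL CL' CR CR' CT CT' : Con .con}
    (hC : Agree ρ C C') (hB : Agree ρ CB CB') (hI : Agree ρ CI CI') (hS : Agree ρ CS CS')
    (hL : Agree ρ CL CL') (hR : Agree ρ CR CR') (hT : Agree ρ CT CT') :
    Agree ρ (.typerec C CB CI CS CL CR CT) (.typerec C' CB' CI' CS' CL' CR' CT') := by
  intro _ _ _ _ h h'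
  cases h with
  | typerec dC dB dI dS dL dR dT => cases h' with
    | typerec dC' dB' dI' dS' dL' dR' dT' =>
      cases hC dC dC'; cases hB dB dB'; cases hI dI dI'; cases hS dS dS'
      cases hL dL dL'; cases hR dR dR'; cases hT dT dT'
      rfl

theorem cons {l : Label} (hC : Agree ρ C C') (hS : Agree ρ S S') :
    Agree ρ (.cons l C S) (.cons l C' S') := by
  intro _ _ _ _ h h'
  cases h with
  | cons dC dS => cases h' with
    | cons dC' dS' => cases hC dC dC'; cases hS dS dS'; rfl

theorem rmap (hC : Agree ρ C C') (hS : Agree ρ S S') :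
    Agree ρ (.rmap C S) (.rmap C' S') := by
  intro _ _ _ _ h h'
  cases h with
  | rmap dC dS => cases h' with
    | rmap dC' dS' => cases hC dC dC'; cases hS dS dS'; rfl

theorem refl (C : Con s) : Agree ρ C C := by
  induction C generalizing ρ with
  | var =>
    intro _ _ _ _ h h'
    cases h with
    | var e _ => cases h' with
      | var e' _ => exact Option.some.inj (e.symm.trans e')
  | bool | int | str | nil => intro _ _ _ _ h h'; cases h; cases h'; rfl
  | lam _ _ ih => exact .lam fun _ => ih
  | app _ _ ihC ihD => exact .app ihC ihD
  | list _ ih => exact .list ih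
  | record _ ih => exact .record ih
  | trace _ ih => exact .trace ih
  | typerec _ _ _ _ _ _ _ ihC ihB ihI ihS ihL ihR ihT =>
    exact .typerec ihC ihB ihI ihS ihL ihR ihT
  | cons _ _ _ ihC ihS => exact .cons ihC ihS
  | rmap _ _ ihC ihS => exact .rmap ihC ihS

end Agree

theorem Den.unique {ρ : Env} {s : Srt} {C : Con s} {k k' : SKind} {v : k.El} {v' : k'.El}
    (h : Den ρ C k v) (h' : Den ρ C k' v') : (⟨k, v⟩ : Sigma SKind.El) = ⟨k', v'⟩ :=
  Agree.refl C h h'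

theorem Agree.of_forall_den {ρ : Env} {s : Srt} {C D : Con s}
    (h : ∀ {k : SKind} {v : k.El}, Den ρ C k v → Den ρ D k v) : Agree ρ C D :=
  fun _ _ _ _ dC dD => (h dC).unique dD

theorem Den.eq_of_lam {ρ : Env} {K : Kind} {C : Con .con} {k : SKind} {f : k.El}
    (h : Den ρ (.lam K C) k f) :
    ∃ k', k = .arr K.erase k' ∧ ∀ v, ∃ w, Den (⟨K.erase, v⟩ :: ρ) C k' w := by
  cases h with
  | lam h => exact ⟨_, rfl, fun v => ⟨_, h v⟩⟩

theorem Den.app_unique {ρ : Env} {s : Srt} {C : Con .con} {D : Con s} {k₁ k₂ k : SKind}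
    {f : k₁.El → k₂.El} {v : k₁.El} {w : k.El} (hC : Den ρ C (.arr k₁ k₂) f)
    (hD : Den ρ D k₁ v) (h : Den ρ (.app C D) k w) :
    (⟨k₂, f v⟩ : Sigma SKind.El) = ⟨k, w⟩ := by
  cases h with
  | app hC' _ hD' => cases hD.unique hD'; cases hC.unique hC'; rfl

theorem Agree.beta {ρ : Env} {s : Srt} {K : Kind} {C : Con .con} {D : Con s} :
    Agree ρ (.app (.lam K C) D) (C.inst D) :=
  .of_forall_den fun h => by
    cases h with
    | app dF hs dD => cases dF with
      | lam dC => exact (dC _).inst hs dD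

section Typerec

variable {ρ : Env} {D : Con .con} {S : Con .row} {CB CI CS CL CR CT : Con .con}

/-- `λα:Type. Typerec α (C_B, …, C_T)` -/
abbrev Con.typerecFn (CB CI CS CL CR CT : Con .con) : Con .con :=
  .lam .type (.typerec (.var .con 0) CB.wk CI.wk CS.wk CL.wk CR.wk CT.wk)

theorem Den.eq_ty_of_typerecFn {k k' : SKind} {b : k.El} {f : k'.El → Val}
    (hB : Den ρ CB k b) (h : Den ρ (Con.typerecFn CB CI CS CL CR CT) (.arr k' .ty) f) :
    k = .ty := by
  obtain ⟨_, hk, h⟩ := h.eq_of_lam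
  obtain ⟨-, rfl⟩ := SKind.arr.inj hk
  obtain ⟨_, h⟩ := h Val.bool
  cases h with
  | typerec _ hB' _ _ _ _ _ => exact congrArg Sigma.fst ((hB.wk _).unique hB')

theorem Agree.typerec_list :
    Agree ρ (.typerec (.list D) CB CI CS CL CR CT)
      (.app (.app CL D) (.typerec D CB CI CS CL CR CT)) := by
  intro _ _ _ _ h h'
  cases h with
  | typerec dC dB dI dS dL dR dT => cases dC with
    | list d => exact (Den.app dL rfl d).app_unique (.typerec d dB dI dS dL dR dT) h'

theorem Agree.typerec_trace :
    Agree ρ (.typerec (.trace D) CB CI CS CL CR CT)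
      (.app (.app CT D) (.typerec D CB CI CS CL CR CT)) := by
  intro _ _ _ _ h h'
  cases h with
  | typerec dC dB dI dS dL dR dT => cases dC with
    | trace d => exact (Den.app dT rfl d).app_unique (.typerec d dB dI dS dL dR dT) h'

theorem Agree.typerec_record :
    Agree ρ (.typerec (.record S) CB CI CS CL CR CT)
      (.app (.app CR S) (.rmap (Con.typerecFn CB CI CS CL CR CT) S)) := by
  intro k _ _ _ h h'
  cases h with
  | @typerec _ _ _ _ _ _ _ _ _ _ b i s fl fr ft dC dB dI dS dL dR dT => cases dC with
    | @record _ _ r dRow =>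
      obtain rfl : k = .ty := by
        cases h' with
        | app _ _ d => cases d with
          | rmap d _ => exact dB.eq_ty_of_typerecFn d
      have dFn : Den ρ (Con.typerecFn CB CI CS CL CR CT) (.arr .ty .ty)
          (Val.typerec ⟨b, i, s, fl, fr, ft⟩) :=
        .lam fun v => .typerec (.var (v := v) rfl rfl) (dB.wk _) (dI.wk _) (dS.wk _) (dL.wk _)
          (dR.wk _) (dT.wk _)
      have dApp := Den.app (.app dR rfl dRow) rfl (.rmap dFn dRow)
      rw [RowVal.map_typerec] at dApp
      exact dApp.unique h'

end Typerec

theorem Con.Red.agree {s : Srt} {C C' : Con s} (hr : Con.Red C C') (ρ : Env) :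
    Agree ρ C C' := by
  induction hr generalizing ρ with
  | consTail _ ih => exact .cons (.refl _) (ih ρ)
  | consHead _ ih => exact .cons (ih ρ) (.refl _)
  | appFun _ ih => exact .app (ih ρ) (.refl _)
  | appArg _ ih => exact .app (.refl _) (ih ρ)
  | beta => exact .beta
  | lam _ ih => exact .lam fun _ => ih _
  | list _ ih => exact .list (ih ρ)
  | trace _ ih => exact .trace (ih ρ)
  | record _ ih => exact .record (ih ρ)
  | rmapNil => exact .of_forall_den fun | .rmap _ .nil => .nil
  | rmapCons =>
    exact .of_forall_den fun | .rmap dC (.cons dD dS) => .cons (.app dC rfl dD) (.rmap dC dS)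
  | rmapRow _ ih => exact .rmap (.refl _) (ih ρ)
  | rmapFun _ ih => exact .rmap (ih ρ) (.refl _)
  | trScrut _ ih =>
    exact .typerec (ih ρ) (.refl _) (.refl _) (.refl _) (.refl _) (.refl _) (.refl _)
  | trB _ ih => exact .typerec (.refl _) (ih ρ) (.refl _) (.refl _) (.refl _) (.refl _) (.refl _)
  | trI _ ih => exact .typerec (.refl _) (.refl _) (ih ρ) (.refl _) (.refl _) (.refl _) (.refl _)
  | trS _ ih => exact .typerec (.refl _) (.refl _) (.refl _) (ih ρ) (.refl _) (.refl _) (.refl _)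
  | trL _ ih => exact .typerec (.refl _) (.refl _) (.refl _) (.refl _) (ih ρ) (.refl _) (.refl _)
  | trR _ ih => exact .typerec (.refl _) (.refl _) (.refl _) (.refl _) (.refl _) (ih ρ) (.refl _)
  | trT _ ih => exact .typerec (.refl _) (.refl _) (.refl _) (.refl _) (.refl _) (.refl _) (ih ρ)
  | trBool => exact .of_forall_den fun | .typerec .bool d _ _ _ _ _ => d
  | trInt => exact .of_forall_den fun | .typerec .int _ d _ _ _ _ => d
  | trStr => exact .of_forall_den fun | .typerec .str _ _ d _ _ _ => d
  | trList => exact .typerec_list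
  | trRecord => exact .typerec_record
  | trTrace => exact .typerec_trace

/-! ### Values of well-kinded constructors -/

/-- Environments that provide a value for each of the variables declared in `Δ`. -/
def Env.Models (ρ : Env) (Δ : List Kind) : Prop :=
  ρ.map Sigma.fst = Δ.map Kind.erase

namespace Env.Models

variable {ρ : Env} {Δ : List Kind}

theorem cons (hρ : ρ.Models Δ) (K : Kind) (v : K.erase.El) :
    Env.Models (⟨K.erase, v⟩ :: ρ) (K :: Δ) :=
  congrArg (K.erase :: ·) hρ

theorem exists_getElem? (hρ : ρ.Models Δ) {n : ℕ} {K : Kind} (h : Δ[n]? = some K) :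
    ∃ v : K.erase.El, ρ[n]? = some ⟨K.erase, v⟩ := by
  have hn : ρ[n]?.map Sigma.fst = some K.erase := by
    rw [← List.getElem?_map, hρ, List.getElem?_map, h, Option.map_some]
  obtain ⟨⟨k, v⟩, hx, rfl⟩ := Option.map_eq_some_iff.mp hn
  exact ⟨v, hx⟩

end Env.Models

theorem Env.exists_models (Δ : List Kind) : ∃ ρ : Env, ρ.Models Δ :=
  ⟨Δ.map fun K => ⟨K.erase, K.erase.default⟩, by simp [Env.Models]⟩

/-- In the environment `ρ`, the constructors `C` and `D` have the same value, of kind `k`. -/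
def SameValue (ρ : Env) {s : Srt} (k : SKind) (C D : Con s) : Prop :=
  ∃ v, Den ρ C k v ∧ Den ρ D k v

namespace SameValue

variable {ρ : Env} {s : Srt} {k k' : SKind} {C C' D D' : Con .con} {S S' : Con .row}

theorem lam {K : Kind} (hC : ∀ v, SameValue (⟨K.erase, v⟩ :: ρ) k C C') :
    SameValue ρ (.arr K.erase k) (.lam K C) (.lam K C') := by
  choose f d d' using hC
  exact ⟨f, .lam d, .lam d'⟩

theorem app {D D' : Con s} (hC : SameValue ρ (.arr k k') C C') (hs : s = k.srt)
    (hD : SameValue ρ k D D') : SameValue ρ k' (.app C D) (.app C' D') :=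
  let ⟨f, dC, dC'⟩ := hC
  let ⟨v, dD, dD'⟩ := hD
  ⟨f v, dC.app hs dD, dC'.app hs dD'⟩

theorem list (hC : SameValue ρ .ty C C') : SameValue ρ .ty (.list C) (.list C') :=
  let ⟨_, d, d'⟩ := hC
  ⟨_, d.list, d'.list⟩

theorem record (hS : SameValue ρ .row S S') : SameValue ρ .ty (.record S) (.record S') :=
  let ⟨_, d, d'⟩ := hS
  ⟨_, d.record, d'.record⟩

theorem trace (hC : SameValue ρ .ty C C') : SameValue ρ .ty (.trace C) (.trace C') :=
  let ⟨_, d, d'⟩ := hC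
  ⟨_, d.trace, d'.trace⟩

theorem typerec {CB CB' CI CI' CS CS' CL CL' CR CR' CT CT' : Con .con}
    (hC : SameValue ρ .ty C C') (hB : SameValue ρ k CB CB') (hI : SameValue ρ k CI CI')
    (hS : SameValue ρ k CS CS') (hL : SameValue ρ (.arr .ty (.arr k k)) CL CL')
    (hR : SameValue ρ (.arr .row (.arr .row k)) CR CR')
    (hT : SameValue ρ (.arr .ty (.arr k k)) CT CT') :
    SameValue ρ k (.typerec C CB CI CS CL CR CT) (.typerec C' CB' CI' CS' CL' CR' CT') :=
  let ⟨_, dC, dC'⟩ := hC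
  let ⟨_, dB, dB'⟩ := hB
  let ⟨_, dI, dI'⟩ := hI
  let ⟨_, dS, dS'⟩ := hS
  let ⟨_, dL, dL'⟩ := hL
  let ⟨_, dR, dR'⟩ := hR
  let ⟨_, dT, dT'⟩ := hT
  ⟨_, dC.typerec dB dI dS dL dR dT, dC'.typerec dB' dI' dS' dL' dR' dT'⟩

theorem nil : SameValue ρ .row .nil .nil := ⟨_, .nil, .nil⟩

theorem cons {l : Label} (hC : SameValue ρ .ty C C') (hS : SameValue ρ .row S S') :
    SameValue ρ .row (.cons l C S) (.cons l C' S') :=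
  let ⟨_, dC, dC'⟩ := hC
  let ⟨_, dS, dS'⟩ := hS
  ⟨_, dC.cons dS, dC'.cons dS'⟩

theorem rmap (hC : SameValue ρ (.arr .ty .ty) C C') (hS : SameValue ρ .row S S') :
    SameValue ρ .row (.rmap C S) (.rmap C' S') :=
  let ⟨_, dC, dC'⟩ := hC
  let ⟨_, dS, dS'⟩ := hS
  ⟨_, dC.rmap dS, dC'.rmap dS'⟩

theorem symm {C C' : Con s} (h : SameValue ρ k C C') : SameValue ρ k C' C :=
  let ⟨v, d, d'⟩ := h
  ⟨v, d', d⟩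

theorem of_agree {C C' : Con s} (h : Agree ρ C C') (hC : SameValue ρ k C C)
    (hC' : SameValue ρ k C' C') : SameValue ρ k C C' := by
  obtain ⟨v, d, -⟩ := hC
  obtain ⟨v', d', -⟩ := hC'
  cases h d d'
  exact ⟨v, d, d'⟩

theorem trans {C C' C'' : Con s} (h : SameValue ρ k C C') (h' : SameValue ρ k C' C'') :
    SameValue ρ k C C'' := by
  obtain ⟨v, dC, dC'⟩ := h
  obtain ⟨v', dC₂, dC''⟩ := h'
  cases dC'.unique dC₂
  exact ⟨v, dC, dC''⟩

theorem eta {K : Kind} (hC : SameValue ρ (.arr K.erase k) C C) :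
    SameValue ρ (.arr K.erase k) (.lam K (.app C.wk (.var K.srt 0))) C :=
  let ⟨f, d, _⟩ := hC
  ⟨f, .lam fun _ => (d.wk _).app (Kind.eq_srt_erase rfl) (.var rfl (Kind.eq_srt_erase rfl)), d⟩

end SameValue

section

variable {Δ : List Kind} {s : Srt} {C D : Con s} {K : Kind}

theorem HasKind.sameValue (h : HasKind Δ C K) {ρ : Env} (hρ : ρ.Models Δ) :
    SameValue ρ K.erase C C := by
  induction h generalizing ρ with
  | sub _ hK ih => exact hK.erase_eq ▸ ih hρ
  | bool => exact ⟨_, .bool, .bool⟩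
  | int => exact ⟨_, .int, .int⟩
  | str => exact ⟨_, .str, .str⟩
  | var hn hs =>
    obtain ⟨v, hv⟩ := hρ.exists_getElem? hn
    have d : Den ρ (.var _ _) _ v := .var hv (Kind.eq_srt_erase hs)
    exact ⟨v, d, d⟩
  | lam _ ih => exact .lam fun v => ih (hρ.cons _ v)
  | app _ hs _ ihC ihD => exact .app (ihC hρ) (Kind.eq_srt_erase hs) (ihD hρ)
  | list _ ih => exact .list (ih hρ)
  | record _ ih => exact .record (ih hρ)
  | trace _ ih => exact .trace (ih hρ)
  | typerec _ _ _ _ _ _ _ ihC ihB ihI ihS ihL ihR ihT =>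
    exact .typerec (ihC hρ) (ihB hρ) (ihI hρ) (ihS hρ) (ihL hρ) (ihR hρ) (ihT hρ)
  | nil | nilBase => exact .nil
  | cons _ _ ihC ihS | consBase _ _ ihC ihS => exact .cons (ihC hρ) (ihS hρ)
  | rmap _ _ ihC ihS => exact .rmap (ihC hρ) (ihS hρ)

theorem HasKind.exists_den (h : HasKind Δ C K) : ∃ ρ v, Den ρ C K.erase v :=
  let ⟨ρ, hρ⟩ := Env.exists_models Δ
  let ⟨v, d, _⟩ := h.sameValue hρ
  ⟨ρ, v, d⟩

theorem ConEq.sameValue (h : ConEq Δ C D K) {ρ : Env} (hρ : ρ.Models Δ) :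
    SameValue ρ K.erase C D := by
  induction h generalizing ρ with
  | refl h => exact h.sameValue hρ
  | symm _ ih => exact (ih hρ).symm
  | trans _ _ ih ih' => exact (ih hρ).trans (ih' hρ)
  | sub _ hK ih => exact hK.erase_eq ▸ ih hρ
  | eta h => exact .eta (h.sameValue hρ)
  | lam _ ih => exact .lam fun v => ih (hρ.cons _ v)
  | app _ hs _ ihC ihD => exact .app (ihC hρ) (Kind.eq_srt_erase hs) (ihD hρ)
  | list _ ih => exact .list (ih hρ)
  | record _ ih => exact .record (ih hρ)
  | trace _ ih => exact .trace (ih hρ)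
  | red hC hD hr => exact .of_agree (hr.agree ρ) (hC.sameValue hρ) (hD.sameValue hρ)
  | nil => exact .nil
  | cons _ _ ihC ihS | consBase _ _ ihC ihS => exact .cons (ihC hρ) (ihS hρ)
  | rmap _ _ ihC ihS => exact .rmap (ihC hρ) (ihS hρ)
  | typerec _ _ _ _ _ _ _ ihC ihB ihI ihS ihL ihR ihT =>
    exact .typerec (ihC hρ) (ihB hρ) (ihI hρ) (ihS hρ) (ihL hρ) (ihR hρ) (ihT hρ)

end

/-! ### Heads of types -/

/-- The outermost formers of types and row types.  The head of a record type includes the head of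
its row, so that it determines the first label. -/
inductive Head : Srt → Type
  | bool : Head .con
  | int : Head .con
  | str : Head .con
  | fn : Head .con
  | list : Head .con
  | record (h : Head .row) : Head .con
  | trace : Head .con
  | all (K : Kind) : Head .con
  | nil : Head .row
  | cons (l : Label) : Head .row

/-- The head of the row type that a row of type codes stands for. -/
def RowVal.head : RowVal → Head .row
  | .nil => .nil
  | .cons l _ _ => .cons l

/-- The head of the type that a type code stands for. -/
def Val.head : Val → Head .con
  | .bool => .bool
  | .int => .int
  | .str => .str
  | .list _ => .list
  | .record r => .record r.head
  | .trace _ => .trace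

/-- `HeadOf ρ A h`: in the environment `ρ`, the type or row type `A` is equivalent to one with the
outermost former `h`.  For `T(C)` it is read off the value of `C`. -/
inductive HeadOf (ρ : Env) : {s : Srt} → Ty s → Head s → Prop
  | T {C : Con .con} {v : Val} : Den ρ C .ty v → HeadOf ρ (.T C) v.head
  | TRow {S : Con .row} {r : RowVal} : Den ρ S .row r → HeadOf ρ (.T S) r.head
  | bool : HeadOf ρ .bool .bool
  | int : HeadOf ρ .int .int
  | str : HeadOf ρ .str .str
  | fn {A B : Ty .con} : HeadOf ρ (.fn A B) .fn
  | list {A : Ty .con} : HeadOf ρ (.list A) .list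
  | record {R : Ty .row} {h : Head .row} : HeadOf ρ R h → HeadOf ρ (.record R) (.record h)
  | trace {A : Ty .con} : HeadOf ρ (.trace A) .trace
  | all {K : Kind} {A : Ty .con} : HeadOf ρ (.all K A) (.all K)
  | nil : HeadOf ρ .nil .nil
  | cons {l : Label} {A : Ty .con} {R : Ty .row} : HeadOf ρ (.cons l A R) (.cons l)

section

variable {ρ : Env} {Δ : List Kind} {s : Srt} {A B : Ty s} {K : Kind}

theorem HeadOf.unique {h h' : Head s} (hA : HeadOf ρ A h) (hA' : HeadOf ρ A h') : h = h' := by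
  induction hA with
  | T d => cases hA' with
    | T d' => cases d.unique d'; rfl
  | TRow d => cases hA' with
    | TRow d' => cases d.unique d'; rfl
  | record _ ih => cases hA' with
    | record hR => exact congrArg Head.record (ih hR)
  | _ => cases hA'; rfl

theorem TyKind.exists_head (h : TyKind Δ A K) (hρ : ρ.Models Δ) : ∃ hd, HeadOf ρ A hd := by
  induction h with
  | sub _ _ ih => exact ih hρ
  | T hC | TBase hC =>
    obtain ⟨_, d, -⟩ := hC.sameValue hρ
    exact ⟨_, .T d⟩
  | TRow hS | TBaseRow hS =>
    obtain ⟨_, d, -⟩ := hS.sameValue hρ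
    exact ⟨_, .TRow d⟩
  | record _ ih =>
    obtain ⟨_, hR⟩ := ih hρ
    exact ⟨_, .record hR⟩
  | _ => exact ⟨_, by constructor⟩

theorem TyEq.exists_head (h : TyEq Δ A B K) (hρ : ρ.Models Δ) :
    ∃ hd, HeadOf ρ A hd ∧ HeadOf ρ B hd := by
  induction h with
  | refl hA =>
    obtain ⟨hd, h⟩ := hA.exists_head hρ
    exact ⟨hd, h, h⟩
  | symm _ ih =>
    obtain ⟨hd, hB, hA⟩ := ih hρ
    exact ⟨hd, hA, hB⟩
  | trans _ _ ih ih' =>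
    obtain ⟨hd, hA, hB⟩ := ih hρ
    obtain ⟨_, hB', hC⟩ := ih' hρ
    exact ⟨hd, hA, hB.unique hB' ▸ hC⟩
  | sub _ _ ih => exact ih hρ
  | TBool => exact ⟨_, .T .bool, .bool⟩
  | TInt => exact ⟨_, .T .int, .int⟩
  | TStr => exact ⟨_, .T .str, .str⟩
  | TList hC =>
    obtain ⟨_, d, -⟩ := hC.sameValue hρ
    exact ⟨_, .T d.list, .list⟩
  | TRecord hS =>
    obtain ⟨_, d, -⟩ := hS.sameValue hρ
    exact ⟨_, .T d.record, .record (.TRow d)⟩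
  | TTrace hC =>
    obtain ⟨_, d, -⟩ := hC.sameValue hρ
    exact ⟨_, .T d.trace, .trace⟩
  | TNil => exact ⟨_, .TRow .nil, .nil⟩
  | TCons hC hS =>
    obtain ⟨_, dC, -⟩ := hC.sameValue hρ
    obtain ⟨_, dS, -⟩ := hS.sameValue hρ
    exact ⟨_, .TRow (dC.cons dS), .cons⟩
  | T h | TBase h =>
    obtain ⟨_, d, d'⟩ := h.sameValue hρ
    exact ⟨_, .T d, .T d'⟩
  | TRow h | TBaseRow h =>
    obtain ⟨_, d, d'⟩ := h.sameValue hρ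
    exact ⟨_, .TRow d, .TRow d'⟩
  | record _ ih =>
    obtain ⟨_, hR, hR'⟩ := ih hρ
    exact ⟨_, .record hR, .record hR'⟩
  | list => exact ⟨_, .list, .list⟩
  | trace => exact ⟨_, .trace, .trace⟩
  | fn => exact ⟨_, .fn, .fn⟩
  | all => exact ⟨_, .all, .all⟩
  | nil => exact ⟨_, .nil, .nil⟩
  | cons | consBase => exact ⟨_, .cons, .cons⟩

end

/-! ### Canonical forms -/

/-- The possible outermost formers of a normal term, depending on the head of its type. -/
inductive CanonicalForm : Tm → Head .con → Prop
  | constBool {b : Bool} : CanonicalForm (.const (.bool b)) .bool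
  | constInt {i : ℤ} : CanonicalForm (.const (.int i)) .int
  | constStr {w : String} : CanonicalForm (.const (.str w)) .str
  | eq {M N : Tm} : Normal M → Normal N → CanonicalForm (.eq M N) .bool
  | plus {M N : Tm} : CanonicalForm (.plus M N) .int
  | lam {A : Ty .con} {M : Tm} : CanonicalForm (.lam A M) .fn
  | tlam {K : Kind} {M : Tm} : CanonicalForm (.tlam K M) (.all K)
  | unit : CanonicalForm .unit (.record .nil)
  | ext {l : Label} {M N : Tm} : CanonicalForm (.ext l M N) (.record (.cons l))
  | rmap {U : Con .row} {M N : Tm} {h : Head .row} :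
      NeutralR U → Normal M → Normal N → CanonicalForm (.rmap U M N) (.record h)
  | nil : CanonicalForm .nil .list
  | single {M : Tm} : CanonicalForm (.single M) .list
  | append {M N : Tm} : CanonicalForm (.append M N) .list
  | comprehension {M N : Tm} : CanonicalForm (.for M N) .list
  | table {n : String} {R : Ty .row} : CanonicalForm (.table n R) .list
  | trLit {M : Tm} : CanonicalForm (.trLit M) .trace
  | trIf {M : Tm} : CanonicalForm (.trIf M) .trace
  | trFor {C : Con .con} {M : Tm} : CanonicalForm (.trFor C M) .trace
  | trCell {M : Tm} : CanonicalForm (.trCell M) .trace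
  | trOpEq {C : Con .con} {M : Tm} : CanonicalForm (.trOpEq C M) .trace
  | trOpPlus {M : Tm} : CanonicalForm (.trOpPlus M) .trace
  | ite {L M N : Tm} {h : Head .con} : CanonicalForm (.ite L M N) h
  | neutral {M : Tm} {h : Head .con} : Neutral M → CanonicalForm M h

section

variable {Δ : List Kind} {Γ : List (Ty .con)} {M : Tm} {A : Ty .con} {hd : Head .con}

theorem HasType.canonicalForm_of_models (h : HasType Δ Γ M A) (hM : Normal M) {ρ : Env}
    (hρ : ρ.Models Δ) (hA : HeadOf ρ A hd) : CanonicalForm M hd := by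
  induction h generalizing hd with
  | @const _ _ c => cases c <;> cases hA <;> constructor
  | conv _ hAB ih =>
    obtain ⟨_, hA', hB⟩ := hAB.exists_head hρ
    exact ih hM hρ (hA.unique hA' ▸ hB)
  | rmap => cases hM with
    | neutral hF => exact .neutral hF
    | rmap hU hM hN => cases hA with
      | T d => cases d with
        | record => exact .rmap hU hM hN
  | eq => cases hM with
    | neutral hF => exact .neutral hF
    | eq hM hN => cases hA; exact .eq hM hN
  | ite => exact .ite
  | unit | ext => cases hA with
    | record hR => cases hR; constructor
  | _ => cases hM with
    | neutral hF => exact .neutral hF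
    | _ => cases hA; constructor

theorem HasType.canonicalForm (h : HasType Δ Γ M A) (hA : ∀ ρ, HeadOf ρ A hd) (hM : Normal M) :
    CanonicalForm M hd :=
  let ⟨ρ, hρ⟩ := Env.exists_models Δ
  h.canonicalForm_of_models hM hρ (hA ρ)

end

/-! ### Progress -/

/-- The expression `a` is in normal form, as described by `N`, or reducible by the relation `R`.
This is used for constructors as well as for terms. -/
inductive Progress {α : Type} (N : α → Prop) (R : α → α → Prop) (a : α) : Prop
  | normal (h : N a)
  | step {a' : α} (h : R a a')

namespace Progress

variable {α β γ : Type} {N : α → Prop} {R : α → α → Prop} {N' : β → Prop} {R' : β → β → Prop}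
  {N'' : γ → Prop} {R'' : γ → γ → Prop} {a : α} {b : β}

theorem elim {P : Prop} (h : Progress N R a) (step : ∀ {a'}, R a a' → P) (normal : N a → P) :
    P :=
  match h with
  | .normal h => normal h
  | .step h => step h

theorem map (f : α → β) (h : Progress N R a) (step : ∀ {a'}, R a a' → R' (f a) (f a'))
    (normal : N a → N' (f a)) : Progress N' R' (f a) :=
  h.elim (fun r => .step (step r)) fun n => .normal (normal n)

theorem map₂ (f : α → β → γ) (ha : Progress N R a) (hb : Progress N' R' b)
    (step₁ : ∀ {a'}, R a a' → R'' (f a b) (f a' b))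
    (step₂ : ∀ {b'}, R' b b' → R'' (f a b) (f a b'))
    (normal : N a → N' b → N'' (f a b)) : Progress N'' R'' (f a b) :=
  ha.elim (fun r => .step (step₁ r)) fun n => hb.map (f a) step₂ (normal n)

end Progress

/-- `NormalC` and `NormalR` at once. -/
def Con.Normal : {s : Srt} → Con s → Prop
  | .con, C => NormalC C
  | .row, S => NormalR S

section Constructors

variable {Δ : List Kind} {s : Srt} {C D CB CI CS CL CR CT : Con .con} {S : Con .row}

theorem NeutralC.app {D : Con s} (hC : NeutralC C) (hD : D.Normal) : NeutralC (.app C D) :=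
  match s with
  | .con => hC.appC hD
  | .row => hC.appR hD

theorem HasKind.not_lam_type {K : Kind} : ¬ HasKind Δ (.lam K C) .type := by
  intro h
  obtain ⟨_, _, d⟩ := h.exists_den
  cases d

theorem HasKind.neutral_or_lam {K₁ K₂ : Kind} (h : HasKind Δ C (.arr K₁ K₂)) (hC : NormalC C) :
    NeutralC C ∨ ∃ K C', K.srt = K₁.srt ∧ C = .lam K C' := by
  obtain ⟨ρ, f, d⟩ := h.exists_den
  replace d : Den ρ C (.arr K₁.erase K₂.erase) f := d
  cases hC with
  | neutral hE => exact .inl hE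
  | @lam K C' =>
    obtain ⟨_, hK, -⟩ := d.eq_of_lam
    obtain ⟨hK, -⟩ := SKind.arr.inj hK
    exact .inr ⟨K, C', by rw [← K.srt_erase, ← hK, K₁.srt_erase], rfl⟩
  | _ => cases d

theorem HasKind.progress_app {K₁ K₂ : Kind} {D : Con s} (h : HasKind Δ C (.arr K₁ K₂))
    (hs : s = K₁.srt) (hC : Progress Con.Normal Con.Red C) (hD : Progress Con.Normal Con.Red D) :
    Progress Con.Normal Con.Red (.app C D) := by
  refine hC.elim (fun r => .step r.appFun) fun nC => ?_
  refine hD.elim (fun r => .step r.appArg) fun nD => ?_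
  obtain hE | ⟨K, C', hK, rfl⟩ := h.neutral_or_lam nC
  · exact .normal (.neutral (hE.app nD))
  · exact .step (.beta (hs.trans hK.symm))

theorem HasKind.progress_typerec (h : HasKind Δ C .type) (hC : Progress Con.Normal Con.Red C)
    (hB : Progress Con.Normal Con.Red CB) (hI : Progress Con.Normal Con.Red CI)
    (hS : Progress Con.Normal Con.Red CS) (hL : Progress Con.Normal Con.Red CL)
    (hR : Progress Con.Normal Con.Red CR) (hT : Progress Con.Normal Con.Red CT) :
    Progress Con.Normal Con.Red (.typerec C CB CI CS CL CR CT) := by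
  refine hC.elim (fun r => .step r.trScrut) fun nC => ?_
  refine hB.elim (fun r => .step r.trB) fun nB => ?_
  refine hI.elim (fun r => .step r.trI) fun nI => ?_
  refine hS.elim (fun r => .step r.trS) fun nS => ?_
  refine hL.elim (fun r => .step r.trL) fun nL => ?_
  refine hR.elim (fun r => .step r.trR) fun nR => ?_
  refine hT.elim (fun r => .step r.trT) fun nT => ?_
  cases nC with
  | neutral hE => exact .normal (.neutral (.typerec hE nB nI nS nL nR nT))
  | bool => exact .step .trBool
  | int => exact .step .trInt
  | str => exact .step .trStr
  | lam => exact absurd h not_lam_type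
  | list => exact .step .trList
  | record => exact .step .trRecord
  | trace => exact .step .trTrace

theorem Progress.conRmap (hC : Progress Con.Normal Con.Red C) (hS : Progress Con.Normal Con.Red S) :
    Progress Con.Normal Con.Red (.rmap C S) := by
  refine hC.elim (fun r => .step r.rmapFun) fun nC => ?_
  refine hS.elim (fun r => .step r.rmapRow) fun nS => ?_
  cases nS with
  | nil => exact .step .rmapNil
  | cons => exact .step .rmapCons
  | neutral hU => exact .normal (.neutral (.rmap nC hU))

theorem HasKind.progress {C : Con s} {K : Kind} (h : HasKind Δ C K) :
    Progress Con.Normal Con.Red C := by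
  induction h with
  | sub _ _ ih => exact ih
  | bool => exact .normal .bool
  | int => exact .normal .int
  | str => exact .normal .str
  | @var _ s => cases s with
    | con => exact .normal (.neutral .var)
    | row => exact .normal (.neutral .var)
  | lam _ ih => exact ih.map _ .lam .lam
  | app hC hs _ ihC ihD => exact hC.progress_app hs ihC ihD
  | list _ ih => exact ih.map _ .list .list
  | record _ ih => exact ih.map _ .record .record
  | trace _ ih => exact ih.map _ .trace .trace
  | typerec hC _ _ _ _ _ _ ihC ihB ihI ihS ihL ihR ihT =>
    exact hC.progress_typerec ihC ihB ihI ihS ihL ihR ihT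
  | nil | nilBase => exact .normal .nil
  | cons _ _ ihC ihS | consBase _ _ ihC ihS =>
    exact .map₂ (Con.cons _) ihC ihS .consHead .consTail .cons
  | rmap _ _ ihC ihS => exact ihC.conRmap ihS

theorem NormalR.eq_rowOf_or_neutral : {S : Con .row} → NormalR S →
    (∃ fs, S = rowOf fs) ∨ NeutralR S
  | _, .nil => .inl ⟨[], rfl⟩
  | _, .neutral hU => .inr hU
  | .cons l C _, .cons hC hS =>
    match hS.eq_rowOf_or_neutral with
    | .inl ⟨fs, hfs⟩ => .inl ⟨(l, C) :: fs, congrArg (Con.cons l C) hfs⟩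
    | .inr hU => .inr (.cons hC hU)

end Constructors

section Terms

variable {Δ : List Kind} {Γ : List (Ty .con)} {s : Srt} {A B : Ty .con} {L M N : Tm}
  {S : Con .row}

theorem Neutral.tapp {C : Con s} (hM : Neutral M) (hC : C.Normal) : Neutral (.tapp M C) :=
  match s with
  | .con => hM.tappC hC
  | .row => hM.tappR hC

theorem HasType.progress_app (h : HasType Δ Γ M (.fn A B)) (hM : Progress Normal Tm.Red M)
    (hN : Progress Normal Tm.Red N) : Progress Normal Tm.Red (.app M N) := by
  refine hM.elim (fun r => .step r.app₁) fun nM => ?_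
  refine hN.elim (fun r => .step r.app₂) fun nN => ?_
  cases h.canonicalForm (fun _ => .fn) nM with
  | neutral hF => exact .normal (.neutral (.app hF nN))
  | ite => exact .step .ccApp
  | lam => exact .step .beta

theorem HasType.progress_tapp {K : Kind} {C : Con s} (h : HasType Δ Γ M (.all K A))
    (hs : s = K.srt) (hM : Progress Normal Tm.Red M) (hC : Progress Con.Normal Con.Red C) :
    Progress Normal Tm.Red (.tapp M C) := by
  refine hM.elim (fun r => .step r.tapp₁) fun nM => ?_
  refine hC.elim (fun r => .step (.tapp₂ r)) fun nC => ?_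
  cases h.canonicalForm (fun _ => .all) nM with
  | neutral hF => exact .normal (.neutral (hF.tapp nC))
  | ite => exact .step .ccTapp
  | tlam => exact .step (.tbeta hs)

theorem HasType.progress_ite (h : HasType Δ Γ L .bool) (hL : Progress Normal Tm.Red L)
    (hM : Progress Normal Tm.Red M) (hN : Progress Normal Tm.Red N) :
    Progress Normal Tm.Red (.ite L M N) := by
  refine hL.elim (fun r => .step r.ite₁) fun nL => ?_
  refine hM.elim (fun r => .step r.ite₂) fun nM => ?_
  refine hN.elim (fun r => .step r.ite₃) fun nN => ?_
  cases h.canonicalForm (fun _ => .bool) nL with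
  | neutral hF => exact .normal (.ite (.neutral hF) nM nN)
  | ite => exact .step .ccIte
  | @constBool b => cases b with
    | false => exact .step .iteFalse
    | true => exact .step .iteTrue
  | eq hM' hN' => exact .normal (.ite (.eq hM' hN') nM nN)

theorem HasType.progress_proj {l : Label} {R : Ty .row}
    (h : HasType Δ Γ M (.record (.cons l A R))) (hM : Progress Normal Tm.Red M) :
    Progress Normal Tm.Red (.proj M l) := by
  refine hM.elim (fun r => .step r.proj) fun nM => ?_
  cases h.canonicalForm (fun _ => .record .cons) nM with
  | neutral hF => exact .normal (.neutral (.proj (.neutral hF)))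
  | ite => exact .step .ccProj
  | ext => exact .step (.projExt .here)
  | rmap hU hM' hN' => exact .normal (.neutral (.proj (.rmap hU hM' hN')))

theorem HasType.progress_for (h : HasType Δ Γ M (.list A)) (hM : Progress Normal Tm.Red M)
    (hN : Progress Normal Tm.Red N) : Progress Normal Tm.Red (.for M N) := by
  refine hM.elim (fun r => .step r.for₁) fun nM => ?_
  refine hN.elim (fun r => .step r.for₂) fun nN => ?_
  cases h.canonicalForm (fun _ => .list) nM with
  | neutral hF => exact .normal (.for (.neutral hF) nN)
  | ite => exact .step .ccForIte
  | nil => exact .step .forNil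
  | single => exact .step .forSingle
  | append => exact .step .ccForAppend
  | comprehension => exact .step .ccForFor
  | table => exact .normal (.for .table nN)

theorem HasType.progress_tracecase {ML MI MF MC ME MP : Tm} (h : HasType Δ Γ M (.trace A))
    (hM : Progress Normal Tm.Red M) (hL : Progress Normal Tm.Red ML)
    (hI : Progress Normal Tm.Red MI) (hF : Progress Normal Tm.Red MF)
    (hC : Progress Normal Tm.Red MC) (hE : Progress Normal Tm.Red ME)
    (hP : Progress Normal Tm.Red MP) :
    Progress Normal Tm.Red (.tracecase M ML MI MF MC ME MP) := by
  refine hM.elim (fun r => .step r.tcScrut) fun nM => ?_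
  refine hL.elim (fun r => .step r.tcL) fun nL => ?_
  refine hI.elim (fun r => .step r.tcI) fun nI => ?_
  refine hF.elim (fun r => .step r.tcF) fun nF => ?_
  refine hC.elim (fun r => .step r.tcC) fun nC => ?_
  refine hE.elim (fun r => .step r.tcE) fun nE => ?_
  refine hP.elim (fun r => .step r.tcP) fun nP => ?_
  cases h.canonicalForm (fun _ => .trace) nM with
  | neutral hF => exact .normal (.neutral (.tracecase hF nL nI nF nC nE nP))
  | ite => exact .step .ccTracecase
  | trLit => exact .step .tcLit
  | trIf => exact .step .tcIf
  | trFor => exact .step .tcFor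
  | trCell => exact .step .tcCell
  | trOpEq => exact .step .tcOpEq
  | trOpPlus => exact .step .tcOpPlus

theorem HasKind.progress_typecase {C : Con .con} {MB MI MS ML MR MT : Tm} (h : HasKind Δ C .type)
    (hB : Progress Normal Tm.Red MB) (hI : Progress Normal Tm.Red MI)
    (hS : Progress Normal Tm.Red MS) (hL : Progress Normal Tm.Red ML)
    (hR : Progress Normal Tm.Red MR) (hT : Progress Normal Tm.Red MT) :
    Progress Normal Tm.Red (.typecase C MB MI MS ML MR MT) := by
  refine h.progress.elim (fun r => .step (.tyScrut r)) fun nC => ?_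
  refine hB.elim (fun r => .step r.tyB) fun nB => ?_
  refine hI.elim (fun r => .step r.tyI) fun nI => ?_
  refine hS.elim (fun r => .step r.tyS) fun nS => ?_
  refine hL.elim (fun r => .step r.tyL) fun nL => ?_
  refine hR.elim (fun r => .step r.tyR) fun nR => ?_
  refine hT.elim (fun r => .step r.tyT) fun nT => ?_
  cases nC with
  | neutral hE => exact .normal (.neutral (.typecase hE nB nI nS nL nR nT))
  | bool => exact .step .tyBool
  | int => exact .step .tyInt
  | str => exact .step .tyStr
  | lam => exact absurd h not_lam_type
  | list => exact .step .tyList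
  | record => exact .step .tyRecord
  | trace => exact .step .tyTrace

theorem Progress.tmRmap (hS : Progress Con.Normal Con.Red S) (hM : Progress Normal Tm.Red M)
    (hN : Progress Normal Tm.Red N) : Progress Normal Tm.Red (.rmap S M N) := by
  refine hS.elim (fun r => .step (.rmap₁ r)) fun nS => ?_
  refine hM.elim (fun r => .step r.rmap₂) fun nM => ?_
  refine hN.elim (fun r => .step r.rmap₃) fun nN => ?_
  obtain ⟨fs, rfl⟩ | hU := NormalR.eq_rowOf_or_neutral nS
  · exact .step .rmapClosed
  · exact .normal (.rmap hU nM nN)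

theorem Progress.rfold (hS : Progress Con.Normal Con.Red S) (hL : Progress Normal Tm.Red L)
    (hM : Progress Normal Tm.Red M) (hN : Progress Normal Tm.Red N) :
    Progress Normal Tm.Red (.rfold S L M N) := by
  refine hS.elim (fun r => .step (.rfold₁ r)) fun nS => ?_
  refine hL.elim (fun r => .step r.rfold₂) fun nL => ?_
  refine hM.elim (fun r => .step r.rfold₃) fun nM => ?_
  refine hN.elim (fun r => .step r.rfold₄) fun nN => ?_
  obtain ⟨fs, rfl⟩ | hU := NormalR.eq_rowOf_or_neutral nS
  · exact .step .rfoldClosed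
  · exact .normal (.neutral (.rfold hU nL nM nN))

theorem HasType.progress : {Δ : List Kind} → {Γ : List (Ty .con)} → {M : Tm} → {A : Ty .con} →
    HasType Δ Γ M A → Progress Normal Tm.Red M
  | _, _, _, _, .const => .normal .const
  | _, _, _, _, .var _ => .normal (.neutral .var)
  | _, _, _, _, .lam _ hM => hM.progress.map _ .lam .lam
  | _, _, _, _, .app hM hN => hM.progress_app hM.progress hN.progress
  | _, _, _, _, .tlam hM => hM.progress.map _ .tlam .tlam
  | _, _, _, _, .tapp hM hs hC => hM.progress_tapp hs hM.progress hC.progress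
  | _, _, _, _, .fix _ _ => .step .fix
  | _, _, _, _, .ite hL hM hN => hL.progress_ite hL.progress hM.progress hN.progress
  | _, _, _, _, .plus hM hN => .map₂ Tm.plus hM.progress hN.progress .plus₁ .plus₂ .plus
  | _, _, _, _, .eq hM hN _ => .map₂ Tm.eq hM.progress hN.progress .eq₁ .eq₂ .eq
  | _, _, _, _, .table _ => .normal .table
  | _, _, _, _, .nil _ => .normal .nil
  | _, _, _, _, .single hM => hM.progress.map _ .single .single
  | _, _, _, _, .append hM hN =>
    .map₂ Tm.append hM.progress hN.progress .append₁ .append₂ .append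
  | _, _, _, _, .for hM hN => hM.progress_for hM.progress hN.progress
  | _, _, _, _, .unit _ => .normal .unit
  | _, _, _, _, .ext hM hN => .map₂ (Tm.ext _) hM.progress hN.progress .ext₁ .ext₂ .ext
  | _, _, _, _, .proj hM => hM.progress_proj hM.progress
  | _, _, _, _, .conv hM _ => hM.progress
  | _, _, _, _, .rmap hS hM hN => hS.progress.tmRmap hM.progress hN.progress
  | _, _, _, _, .rfold hS hL hM hN => hS.progress.rfold hL.progress hM.progress hN.progress
  | _, _, _, _, .typecase hC _ hB hI hS hL hR hT =>
    hC.progress_typecase hB.progress hI.progress hS.progress hL.progress hR.progress hT.progress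
  | _, _, _, _, .litBool hM | _, _, _, _, .litInt hM | _, _, _, _, .litStr hM =>
    hM.progress.map _ .trLit .trLit
  | _, _, _, _, .trIf hM => hM.progress.map _ .trIf .trIf
  | _, _, _, _, .trFor hC hM => .map₂ Tm.trFor hC.progress hM.progress .trFor₁ .trFor₂ .trFor
  | _, _, _, _, .trCell hM => hM.progress.map _ .trCell .trCell
  | _, _, _, _, .trOpEq hC hM =>
    .map₂ Tm.trOpEq hC.progress hM.progress .trOpEq₁ .trOpEq₂ .trOpEq
  | _, _, _, _, .trOpPlus hM => hM.progress.map _ .trOpPlus .trOpPlus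
  | _, _, _, _, .tracecase hM hL hI hF hC hE hP =>
    hM.progress_tracecase hM.progress hL.progress hI.progress hF.progress hC.progress hE.progress
      hP.progress

end Terms

end LinksT

theorem mainTheorem3 (Δ : List LinksT.Kind) (Γ : List (LinksT.Ty .con)) (M : LinksT.Tm)
    (A : LinksT.Ty .con) (hM : LinksT.HasType Δ Γ M A) :
    LinksT.Normal M ∨ ∃ M' : LinksT.Tm, LinksT.Tm.Red M M' := by
  obtain h | h := hM.progress
  · exact .inl h
  · exact .inr ⟨_, h⟩
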